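/- Fix a base $b>1$ of the logarithm and put $\nu(n)=\dfrac{\log\log\log n+4}{\log\log n}$. A distance matrix is a nonnegative symmetric matrix $M\in\mathbb R^{n\times n}$ with zero diagonal; it is a metric if moreover $M(i,j)=0$ only for $i=j$ and $M(i,j)\le M(i,k)+M(j,k)$ for all $i,j,k$. It is $\varepsilon$-far from a metric if every metric on $n$ points differs from it in at least $\varepsilon n^2$ entries. A (randomized, possibly adaptive) algorithm queries entries of its input distance matrix and answers METRIC or NON-METRIC; its query complexity is the maximal number of queries over all inputs and coin tosses; it is non-adaptive if its queries depend on its coin tosses only. It has one-sided error if it accepts every metric with probability $1$; a one-sided error tester with parameter $\varepsilon$ also rejects every distance matrix that is $\varepsilon$-far from a metric with probability at least $2/3$. **Theorem.** There are $c>0$ and $n_0$ (depending only on $b$) such that for all $n\ge n_0$ and all $\varepsilon\le n^{-\nu(n)}$, every one-sided error tester with parameter $\varepsilon$ on $n\times n$ matrices makes at least $c\,n^{1/3+\nu(n)/3}$ queries, and at least $c\,n^{2/3+2\nu(n)/3}$ queries if it is non-adaptive. **Lemma.** For a set $X\subseteq\mathbb Z/n$ let $G_X$ be the weighted clique on the vertices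 $a_i,b_i,c_i$ ($i\in\mathbb Z/n$) with weights $w(a_i,b_j)=1$ if $j-i\in X$ and $2$ otherwise; $w(b_i,c_j)=2$ if $j-i\in X$ and $3$ otherwise; $w(a_i,c_j)=4$ if $j-i\in 2X=\{2x:x\in X\}$ and $2$ otherwise; and weight $2$ between distinct vertices of the same type. For a bijection $\psi$ from $[3n]$ to the vertices let $M_{X,\psi}(i,j)=w(\psi(i),\psi(j))$, with zero diagonal. Call $X$ 3-AP-free if $x+z=2y$ with $x,y,z\in X$ (modulo $n$) implies $x=y=z$. 1. For all $n\ge1$ and every 3-AP-free $X\subseteq\mathbb Z/n$, exactly $n|X|$ triangles of $G_X$ violate the triangle inequality, they are pairwise edge-disjoint, and for every $\psi$ the minimal number of entries of $M_{X,\psi}$ that have to be modified to obtain a metric is $2n|X|$. 2. For all sufficiently large $n$ there is a 3-AP-free $X\subseteq\mathbb Z/n$ with $n^{1-\nu(n)}\le|X|\le 5n^{1-\nu(n)}$ such that, for every $\psi$, the matrix $M_{X,\psi}$ is $n^{-\nu(n)}$-far from a metric. 3. For every $K$ there are $c>0$ and $n_0$ such that for all $n\ge n_0$ and every 3-AP-free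 $X\subseteq\mathbb Z/n$ with $|X|\le K n^{1-\nu(n)}$: every one-sided error algorithm that rejects $M_{X,\psi}$ with probability at least $2/3$ (over its coin tosses and a uniformly random bijection $\psi$) makes at least $c\,n^{1/3+\nu(n)/3}$ queries, and at least $c\,n^{2/3+2\nu(n)/3}$ queries if it is non-adaptive. -/

import Mathlib

open MeasureTheory

noncomputable section

namespace MetricTesting

/-! ### Distance matrices, metrics, farness -/

/-- The inputs of a tester: nonnegative symmetric matrices with zero diagonal. -/
structure IsDistanceMatrix {n : ℕ} (M : Matrix (Fin n) (Fin n) ℝ) : Prop where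
  nonneg : ∀ i j, 0 ≤ M i j
  symm : ∀ i j, M i j = M j i
  diag : ∀ i, M i i = 0

/-- `M` is a (strict) metric on `n` points. -/
structure IsMetric {n : ℕ} (M : Matrix (Fin n) (Fin n) ℝ) : Prop where
  nonneg : ∀ i j, 0 ≤ M i j
  eq_zero_iff : ∀ i j, M i j = 0 ↔ i = j
  symm : ∀ i j, M i j = M j i
  triangle : ∀ i j k, M i j ≤ M i k + M j k

/-- The `ℓ₀` distance: the number of entries in which two matrices differ. -/
def entryDist {n : ℕ} (M M' : Matrix (Fin n) (Fin n) ℝ) : ℕ :=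
  (Finset.univ.filter fun p : Fin n × Fin n => M p.1 p.2 ≠ M' p.1 p.2).card

/-- `M` is `ε`-far from being a metric: every metric differs from it in at least `ε n²` entries. -/
def IsFar {n : ℕ} (ε : ℝ) (M : Matrix (Fin n) (Fin n) ℝ) : Prop :=
  ∀ M' : Matrix (Fin n) (Fin n) ℝ, IsMetric M' → ε * (n : ℝ) ^ 2 ≤ (entryDist M M' : ℝ)

/-! ### Query algorithms -/

/-- A deterministic (adaptive) query algorithm on `n × n` real matrices: either stop with an answer
(`true` for "METRIC", `false` for "NON-METRIC"), or query one entry and continue depending on the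
value that was read. -/
inductive DecisionTree (n : ℕ) : Type
  | leaf (answer : Bool) : DecisionTree n
  | query (i j : Fin n) (next : ℝ → DecisionTree n) : DecisionTree n

namespace DecisionTree

/-- The answer on input `M`. -/
def output {n : ℕ} : DecisionTree n → Matrix (Fin n) (Fin n) ℝ → Bool
  | leaf r, _ => r
  | query i j next, M => (next (M i j)).output M

/-- The sequence of entries queried on input `M`. -/
def queries {n : ℕ} : DecisionTree n → Matrix (Fin n) (Fin n) ℝ → List (Fin n × Fin n)
  | leaf _, _ => []
  | query i j next, M => (i, j) :: (next (M i j)).queries M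

end DecisionTree

/-- A randomized query algorithm: a random deterministic query algorithm. `Ω` is the probability
space of the internal coin tosses. -/
structure Tester (n : ℕ) where
  Ω : Type
  [mΩ : MeasurableSpace Ω]
  μ : Measure Ω
  [isProb : IsProbabilityMeasure μ]
  tree : Ω → DecisionTree n
  measurableSet_accept : ∀ M : Matrix (Fin n) (Fin n) ℝ, IsDistanceMatrix M →
    MeasurableSet {ω | (tree ω).output M = true}

attribute [instance] Tester.mΩ Tester.isProb

namespace Tester

variable {n : ℕ} (T : Tester n)

/-- Probability of the answer "METRIC" on input `M`. -/
def acceptProb (M : Matrix (Fin n) (Fin n) ℝ) : ℝ :=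
  T.μ.real {ω | (T.tree ω).output M = true}

/-- Probability of the answer "NON-METRIC" on input `M`. -/
def rejectProb (M : Matrix (Fin n) (Fin n) ℝ) : ℝ :=
  T.μ.real {ω | (T.tree ω).output M = false}

/-- `T` makes at most `q` queries, on every input and for all coin tosses. -/
def MakesAtMost (q : ℕ) : Prop :=
  ∀ M : Matrix (Fin n) (Fin n) ℝ, IsDistanceMatrix M → ∀ ω, ((T.tree ω).queries M).length ≤ q

/-- `T` is non-adaptive: the queries depend only on the coin tosses, not on the input. -/
def IsNonadaptive : Prop :=
  ∀ ω, ∀ M M' : Matrix (Fin n) (Fin n) ℝ, IsDistanceMatrix M → IsDistanceMatrix M' →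
    (T.tree ω).queries M = (T.tree ω).queries M'

/-- `T` has one-sided error: every metric is accepted with probability one. -/
def IsOneSided : Prop :=
  ∀ M : Matrix (Fin n) (Fin n) ℝ, IsMetric M → T.acceptProb M = 1

/-- `T` is a one-sided error tester of the metric property with parameter `ε`. -/
def IsOneSidedTester (ε : ℝ) : Prop :=
  T.IsOneSided ∧
    ∀ M : Matrix (Fin n) (Fin n) ℝ, IsDistanceMatrix M → IsFar ε M → 2 / 3 ≤ T.rejectProb M

end Tester

/-! ### The weighted clique -/

/-- `ν(n) = (log log log n + 4) / log log n`, with logarithms to the base `b`. -/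
def nu (b : ℝ) (n : ℕ) : ℝ :=
  (Real.logb b (Real.logb b (Real.logb b n)) + 4) / Real.logb b (Real.logb b n)

/-- The vertex set `A ∪ B ∪ C`: three disjoint copies of the labels `1, …, n`, read modulo `n`. -/
abbrev Vertex (n : ℕ) : Type := ZMod n ⊕ ZMod n ⊕ ZMod n

open Classical in
/-- The edge weights of the clique on `A ∪ B ∪ C` given by `X` (and `0` on the diagonal).
`Sum.inl` is `A`, `Sum.inr ∘ Sum.inl` is `B`, `Sum.inr ∘ Sum.inr` is `C`. -/
def weight {n : ℕ} (X : Finset (ZMod n)) : Vertex n → Vertex n → ℝ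
  | .inl i, .inl j => if i = j then 0 else 2
  | .inr (.inl i), .inr (.inl j) => if i = j then 0 else 2
  | .inr (.inr i), .inr (.inr j) => if i = j then 0 else 2
  | .inl i, .inr (.inl j) => if ∃ x ∈ X, j - i = x then 1 else 2
  | .inr (.inl j), .inl i => if ∃ x ∈ X, j - i = x then 1 else 2
  | .inr (.inl i), .inr (.inr j) => if ∃ x ∈ X, j - i = x then 2 else 3
  | .inr (.inr j), .inr (.inl i) => if ∃ x ∈ X, j - i = x then 2 else 3
  | .inl i, .inr (.inr j) => if ∃ x ∈ X, j - i = 2 * x then 4 else 2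
  | .inr (.inr j), .inl i => if ∃ x ∈ X, j - i = 2 * x then 4 else 2

/-- The `3n × 3n` matrix of the weighted clique under the labelling `ψ` of its vertices. -/
def cliqueMatrix {n : ℕ} (X : Finset (ZMod n)) (ψ : Fin (3 * n) ≃ Vertex n) :
    Matrix (Fin (3 * n)) (Fin (3 * n)) ℝ :=
  fun i j => weight X (ψ i) (ψ j)

/-- The three vertices in `s` form a triangle that violates the triangle inequality. -/
def IsViolatingTriangle {V : Type*} [DecidableEq V] (w : V → V → ℝ) (s : Finset V) : Prop :=
  ∃ u v t : V, u ≠ v ∧ v ≠ t ∧ u ≠ t ∧ s = {u, v, t} ∧ w u v + w v t < w u t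

/-- The probability that `T` rejects the matrix of the weighted clique, over the coin tosses of `T`
and a uniformly random labelling of the vertices. -/
def avgRejectProb {n : ℕ} [NeZero n] (T : Tester (3 * n)) (X : Finset (ZMod n)) : ℝ :=
  (∑ ψ : Fin (3 * n) ≃ Vertex n, T.rejectProb (cliqueMatrix X ψ)) /
    (Fintype.card (Fin (3 * n) ≃ Vertex n) : ℝ)

end MetricTesting

end

open MetricTesting

/-! The ranges of the weights leave only one way to break a triangle inequality: a path from `A`
through `B` to `C` with weights 1, 2 against 4. Its differences satisfy `y + z = 2x` in `X`, so they
coincide when `X` is 3-AP-free. The violating triangles are therefore indexed by a label and an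
element of `X`, and an edge determines its triangle. Edge-disjointness bounds the distance to
metrics from below; lowering every 4 to 3 attains the bound.

A one-sided tester may reject only when no metric agrees with the entries it has read. If these
contain no complete violating triangle, the unread ones can be replaced by harmless values to give a
metric (`isMetricOn_cappedWeight`). So the tester has to find one of about `n ^ (2 - ν)` triangles
among about `n ^ 3` triples of randomly labelled points.

Adaptively, `q` queries touch at most `2q` indices. Even if their labels are revealed, the remaining
labelling stays uniform, so exploring is no better than fixing `2q` indices in advance
(`card_explored_le`). These carry at most `(2q) ^ 3` ordered triples, whence `q ^ 3` is at least of
order `n ^ (1 + ν)`. Non-adaptively, the queried entries form a fixed graph with `q` edges and so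
with `O(q ^ (3 / 2))` triangles, which gives the larger bound.

Behrend's construction supplies `X`: its density `exp (-4 √(log n))` exceeds `n ^ (-ν)` by any
constant factor. Sizes not divisible by 3 are reached by padding with points at distance 2. -/

namespace MetricTesting

open Finset

/-! ### Random labellings and adaptive exploration. -/

section Exploration

variable {N : ℕ} {V : Type} [Fintype V] [DecidableEq V]

/-- The matrix of a weight function under a labelling of the vertices. -/
def labelled (w : V → V → ℝ) (ψ : Fin N ≃ V) : Matrix (Fin N) (Fin N) ℝ :=
  fun i j => w (ψ i) (ψ j)

/-- The indices that occur in a list of queries. -/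
def touched (l : List (Fin N × Fin N)) : Finset (Fin N) :=
  (l.map Prod.fst).toFinset ∪ (l.map Prod.snd).toFinset

lemma touched_nil : touched ([] : List (Fin N × Fin N)) = ∅ := by
  simp [touched]

lemma touched_cons (i j : Fin N) (l : List (Fin N × Fin N)) :
    touched ((i, j) :: l) = {i, j} ∪ touched l := by
  ext k
  simp only [touched, List.map_cons, List.toFinset_cons, mem_union, mem_insert, mem_singleton]
  tauto

/-- Serves to condition on the labels just revealed. Only fibres that meet `A` need comparing, so
each comes with a representative. -/
lemma card_le_card_of_fibers {α β : Type*} [Fintype β] [DecidableEq β] (f : α → β)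
    (A B : Finset α)
    (h : ∀ x ∈ A, (A.filter fun y => f y = f x).card ≤ (B.filter fun y => f y = f x).card) :
    A.card ≤ B.card := by
  rw [card_eq_sum_card_fiberwise (f := f) (t := univ) (by simp),
    card_eq_sum_card_fiberwise (f := f) (s := B) (t := univ) (by simp)]
  refine sum_le_sum fun b _ => ?_
  by_cases hb : ∃ x ∈ A, f x = b
  · obtain ⟨x, hx, rfl⟩ := hb
    exact h x hx
  · rw [filter_eq_empty_iff.2 fun x hx hxb => hb ⟨x, hx, hxb⟩]
    simp

open Classical in
/-- Given the labels of `D`, the labels of two sets of further indices of the same size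
are equidistributed. -/
lemma card_labelling_le_of_card_eq (P : Finset V → Prop) (D E E' : Finset (Fin N))
    (ψ₀ : Fin N ≃ V) (hE : Disjoint D E) (hE' : Disjoint D E') (h : E.card = E'.card) :
    (univ.filter fun ψ : Fin N ≃ V => (∀ i ∈ D, ψ i = ψ₀ i) ∧ P ((D ∪ E).image ψ)).card ≤
    (univ.filter fun ψ : Fin N ≃ V => (∀ i ∈ D, ψ i = ψ₀ i) ∧ P ((D ∪ E').image ψ)).card := by
  -- A permutation of the indices that fixes `D` and carries `E'` onto `E`; precomposing with it
  -- maps the first set of labellings injectively into the second.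
  obtain ⟨σ, hσ⟩ := Equiv.Perm.exists_extending_pair
    (Sum.elim (fun x : D => (x : Fin N)) fun x : E' => (x : Fin N))
    (Sum.elim (fun x : D => (x : Fin N)) fun x : E' => ((E'.equivOfCardEq h.symm x : E) : Fin N))
    (Function.Injective.sumElim Subtype.val_injective Subtype.val_injective
      fun a b hab => Finset.disjoint_left.1 hE' a.2 (hab ▸ b.2))
    (Function.Injective.sumElim Subtype.val_injective
      (Subtype.val_injective.comp (Equiv.injective _))
      fun a b hab => Finset.disjoint_left.1 hE a.2 (hab ▸ (E'.equivOfCardEq h.symm b).2))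
  have hD : ∀ i ∈ D, σ i = i := fun i hi => hσ (.inl ⟨i, hi⟩)
  have hEσ : E'.image σ = E := by
    refine eq_of_subset_of_card_le ?_ ?_
    · intro k hk
      obtain ⟨i, hi, rfl⟩ := mem_image.1 hk
      have := hσ (.inr ⟨i, hi⟩)
      simp only [Sum.elim_inr] at this
      rw [this]
      exact (E'.equivOfCardEq h.symm ⟨i, hi⟩).2
    · rw [card_image_of_injective _ σ.injective, h]
  have hDσ : D.image σ = D := by
    rw [image_congr (g := id) fun i hi => hD i hi, image_id]
  refine card_le_card_of_injOn (fun ψ => σ.trans ψ) ?_ ?_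
  · intro ψ hψ
    simp only [coe_filter, mem_univ, true_and, Set.mem_ofPred_eq, Equiv.trans_apply] at hψ ⊢
    refine ⟨fun i hi => by rw [hD i hi, hψ.1 i hi], ?_⟩
    have : (D ∪ E').image (σ.trans ψ) = (D ∪ E).image ψ := by
      rw [Equiv.coe_trans, ← image_image, image_union, hEσ, hDσ]
    rw [this]
    exact hψ.2
  · intro ψ _ ψ' _ hh
    ext i
    have := congrArg (fun e : Fin N ≃ V => e (σ.symm i)) hh
    simpa using this

open Classical in
/-- Exploring the labels adaptively with `q` queries is no better than reading `2 * q` labels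
chosen in advance. -/
theorem card_explored_le (w : V → V → ℝ) (P : Finset V → Prop)
    (hP : ∀ s t : Finset V, s ⊆ t → P s → P t) (t : DecisionTree N) :
    ∀ (D E : Finset (Fin N)) (ψ₀ : Fin N ≃ V) (q : ℕ), Disjoint D E → E.card = 2 * q →
      (∀ ψ : Fin N ≃ V, (∀ i ∈ D, ψ i = ψ₀ i) → (t.queries (labelled w ψ)).length ≤ q) →
      (univ.filter fun ψ : Fin N ≃ V => (∀ i ∈ D, ψ i = ψ₀ i) ∧
        P ((D ∪ touched (t.queries (labelled w ψ))).image ψ)).card ≤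
      (univ.filter fun ψ : Fin N ≃ V => (∀ i ∈ D, ψ i = ψ₀ i) ∧ P ((D ∪ E).image ψ)).card := by
  induction t with
  | leaf r =>
    intro D E ψ₀ q _ _ _
    refine card_le_card fun ψ hψ => ?_
    simp only [mem_filter, mem_univ, true_and, DecisionTree.queries, touched_nil,
      union_empty] at hψ ⊢
    exact ⟨hψ.1, hP _ _ (image_subset_image subset_union_left) hψ.2⟩
  | query i j next ih =>
    intro D E ψ₀ q hDE hEq hlen
    obtain ⟨q, rfl⟩ : ∃ p, q = p + 1 := by
      have := hlen ψ₀ fun _ _ => rfl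
      simp only [DecisionTree.queries, List.length_cons] at this
      exact ⟨q - 1, by omega⟩
    have hnew : (({i, j} : Finset (Fin N)) \ D).card ≤ 2 :=
      (card_le_card sdiff_subset).trans card_le_two
    -- Unrevealed indices are exchangeable, so the indices read in advance may be assumed to include
    -- those touched by the first query. At most two are used up, and at least `2 * q` remain for
    -- `E''`.
    obtain ⟨E', hE'1, hE'2, hE'3⟩ := exists_subsuperset_card_eq
      (s := ({i, j} : Finset (Fin N)) \ D) (t := univ \ D) (n := 2 * (q + 1))
      (sdiff_subset_sdiff (subset_univ _) le_rfl) (by omega)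
      (by
        rw [← hEq]
        exact card_le_card fun x hx => mem_sdiff.2 ⟨mem_univ _, disjoint_right.1 hDE hx⟩)
    have hDE' : Disjoint D E' := disjoint_right.2 fun x hx => (mem_sdiff.1 (hE'2 hx)).2
    refine le_trans ?_
      (card_labelling_le_of_card_eq P D E' E ψ₀ hDE' hDE (hE'3.trans hEq.symm))
    obtain ⟨E'', hE''1, hE''2⟩ := exists_subset_card_eq
      (s := E' \ (({i, j} : Finset (Fin N)) \ D)) (n := 2 * q) (by
        rw [card_sdiff_of_subset hE'1]
        omega)
    have hD'E'' : Disjoint (D ∪ {i, j}) E'' := by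
      refine disjoint_right.2 fun x hx hx' => ?_
      obtain ⟨h1, h2⟩ := mem_sdiff.1 (hE''1 hx)
      have h3 := disjoint_right.1 hDE' h1
      rcases mem_union.1 hx' with h | h
      · exact h3 h
      · exact h2 (mem_sdiff.2 ⟨h, h3⟩)
    have hsub : D ∪ {i, j} ∪ E'' ⊆ D ∪ E' := by
      intro x hx
      rcases mem_union.1 hx with h | h
      · rcases mem_union.1 h with h | h
        · exact mem_union_left _ h
        · by_cases hxD : x ∈ D
          · exact mem_union_left _ hxD
          · exact mem_union_right _ (hE'1 (mem_sdiff.2 ⟨h, hxD⟩))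
      · exact mem_union_right _ (mem_sdiff.1 (hE''1 h)).1
    -- Once the labels on `D ∪ {i, j}` are fixed, the value read is constant and the run continues
    -- in one fixed subtree, to which `ih` applies.
    refine card_le_card_of_fibers
      (fun (ψ : Fin N ≃ V) (x : (D ∪ {i, j} : Finset (Fin N))) => ψ x) _ _ fun ψ₁ hψ₁ => ?_
    simp only [mem_filter, mem_univ, true_and] at hψ₁
    have hi : i ∈ D ∪ {i, j} := by simp
    have hj : j ∈ D ∪ {i, j} := by simp
    have key := ih (w (ψ₁ i) (ψ₁ j)) (D ∪ {i, j}) E'' ψ₁ q hD'E'' hE''2 (by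
      intro ψ hψ
      have := hlen ψ fun k hk => by rw [hψ k (mem_union_left _ hk), hψ₁.1 k hk]
      simp only [DecisionTree.queries, List.length_cons, labelled] at this
      rw [hψ i hi, hψ j hj] at this
      exact Nat.le_of_succ_le_succ this)
    refine (card_le_card ?_).trans (key.trans (card_le_card ?_))
    · intro ψ hψ
      simp only [mem_filter, mem_univ, true_and] at hψ ⊢
      have hag : ∀ k ∈ D ∪ {i, j}, ψ k = ψ₁ k := fun k hk => congrFun hψ.2 ⟨k, hk⟩
      refine ⟨hag, ?_⟩
      have := hψ.1.2
      simp only [DecisionTree.queries, touched_cons, labelled] at this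
      rw [hag i hi, hag j hj] at this
      rw [union_assoc]
      exact this
    · intro ψ hψ
      simp only [mem_filter, mem_univ, true_and] at hψ ⊢
      refine ⟨⟨fun k hk => ?_, hP _ _ (image_subset_image hsub) hψ.2⟩, ?_⟩
      · rw [hψ.1 k (mem_union_left _ hk), hψ₁.1 k hk]
      · funext x
        exact hψ.1 x x.2

open Classical in
/-- Under a uniformly random labelling, a triple of indices is labelled by a uniformly random
triple of vertices. -/
lemma card_labelling_triple_mul (hN : Nonempty (Fin N ≃ V)) (T : Finset (Fin 3 ↪ V))
    (e : Fin 3 ↪ Fin N) :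
    (univ.filter fun ψ : Fin N ≃ V => e.trans ψ.toEmbedding ∈ T).card * N.descFactorial 3 =
      T.card * Fintype.card (Fin N ≃ V) := by
  obtain ⟨ψ₀⟩ := hN
  set F : (Fin 3 ↪ V) → ℕ := fun t =>
    (univ.filter fun ψ : Fin N ≃ V => e.trans ψ.toEmbedding = t).card with hF
  -- Permuting the vertices moves any triple to any other, so all fibres have the same size.
  have hle : ∀ t t', F t ≤ F t' := by
    intro t t'
    obtain ⟨σ, hσ⟩ := Equiv.Perm.exists_extending_pair t t' t.injective t'.injective
    refine card_le_card_of_injOn (fun ψ => ψ.trans σ) ?_ ?_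
    · intro ψ hψ
      simp only [coe_filter, mem_univ, true_and, Set.mem_ofPred_eq] at hψ ⊢
      ext k
      rw [← hσ k, ← hψ]
      rfl
    · intro ψ _ ψ' _ hh
      ext i
      exact σ.injective (congrArg (fun e : Fin N ≃ V => e i) hh)
  have hconst : ∀ t, F t = F (e.trans ψ₀.toEmbedding) := fun t => le_antisymm (hle _ _) (hle _ _)
  have h1 : (univ.filter fun ψ : Fin N ≃ V => e.trans ψ.toEmbedding ∈ T).card =
      T.card * F (e.trans ψ₀.toEmbedding) := by
    rw [card_eq_sum_card_fiberwise (f := fun ψ : Fin N ≃ V => e.trans ψ.toEmbedding) (t := T)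
      (by intro ψ hψ; simpa using hψ), ← smul_eq_mul, ← sum_const]
    refine sum_congr rfl fun t ht => ?_
    rw [← hconst t, hF]
    congr 1
    ext ψ
    simp only [mem_filter, mem_univ, true_and]
    exact ⟨fun h => h.2, fun h => ⟨h ▸ ht, h⟩⟩
  have h2 : Fintype.card (Fin N ≃ V) = N.descFactorial 3 * F (e.trans ψ₀.toEmbedding) := by
    have : Fintype.card (Fin 3 ↪ V) = N.descFactorial 3 := by
      rw [Fintype.card_embedding_eq, ← Fintype.card_congr ψ₀, Fintype.card_fin, Fintype.card_fin]
    rw [← this, ← card_univ, card_eq_sum_card_fiberwise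
      (f := fun ψ : Fin N ≃ V => e.trans ψ.toEmbedding) (t := univ) (by simp), ← card_univ,
      ← smul_eq_mul, ← sum_const]
    exact sum_congr rfl fun t _ => hconst t
  rw [h1, h2]
  ring

open Classical in
lemma card_labelling_exists_triple_mul_le (hN : Nonempty (Fin N ≃ V)) (T : Finset (Fin 3 ↪ V))
    (S : Finset (Fin 3 ↪ Fin N)) :
    (univ.filter fun ψ : Fin N ≃ V => ∃ e ∈ S, e.trans ψ.toEmbedding ∈ T).card *
      N.descFactorial 3 ≤ S.card * T.card * Fintype.card (Fin N ≃ V) := by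
  have : (univ.filter fun ψ : Fin N ≃ V => ∃ e ∈ S, e.trans ψ.toEmbedding ∈ T) ⊆
      S.biUnion fun e => univ.filter fun ψ : Fin N ≃ V => e.trans ψ.toEmbedding ∈ T := by
    intro ψ hψ
    simpa using hψ
  calc _ ≤ (∑ e ∈ S, (univ.filter fun ψ : Fin N ≃ V => e.trans ψ.toEmbedding ∈ T).card) *
        N.descFactorial 3 := Nat.mul_le_mul_right _ ((card_le_card this).trans card_biUnion_le)
    _ = _ := by
      rw [sum_mul, sum_congr rfl fun e _ => card_labelling_triple_mul hN T e, sum_const,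
        smul_eq_mul, mul_assoc]

end Exploration

/-! ### Triangles in the graph of queried entries. -/

section Triangles

variable {N : ℕ}

/-- The entry `(i, j)` or its mirror image belongs to `S`. -/
def Asks (S : Finset (Fin N × Fin N)) (i j : Fin N) : Prop := (i, j) ∈ S ∨ (j, i) ∈ S

lemma Asks.symm {S : Finset (Fin N × Fin N)} {i j : Fin N} (h : Asks S i j) : Asks S j i :=
  Or.symm h

open Classical in
/-- The triples of indices all of whose entries are in `S`. -/
noncomputable def askedTriples (S : Finset (Fin N × Fin N)) : Finset (Fin 3 ↪ Fin N) :=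
  univ.filter fun e => Asks S (e 0) (e 1) ∧ Asks S (e 1) (e 2) ∧ Asks S (e 0) (e 2)

open Classical in
/-- A graph with `m` edges has at most `(2 * m) ^ (3 / 2)` ordered triangles. -/
lemma card_askedTriples_sq_le (S : Finset (Fin N × Fin N)) :
    (askedTriples S).card ^ 2 ≤ (2 * S.card) ^ 3 := by
  set R : Finset (Fin N × Fin N) := S ∪ S.image Prod.swap with hR
  have hRc : R.card ≤ 2 * S.card := by
    have h1 : R.card ≤ _ := card_union_le S (S.image Prod.swap)
    have h2 : (S.image Prod.swap).card ≤ S.card := card_image_le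
    omega
  have hA : ∀ i j, Asks S i j ↔ (i, j) ∈ R := by
    intro i j
    simp [Asks, hR]
  set d : Fin N → ℕ := fun z => (univ.filter fun x => (z, x) ∈ R).card with hd
  have hdsum : ∑ z, d z = R.card := by
    rw [card_eq_sum_card_fiberwise (f := Prod.fst) (t := univ) (by simp)]
    refine sum_congr rfl fun z _ => ?_
    refine card_bij (fun x _ => (z, x)) ?_ ?_ ?_
    · intro x hx
      simpa using hx
    · intro x _ y _ h
      exact (Prod.mk.inj h).2
    · rintro ⟨z', x⟩ hx
      simp only [mem_filter] at hx
      obtain ⟨hx, rfl⟩ := hx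
      exact ⟨x, by simpa using hx, rfl⟩
  -- The triangles at `z` are determined by the opposite edge, giving `R.card`, and by two
  -- neighbours, giving `d z * d z`. The geometric mean of the two bounds is linear in `d z` and
  -- sums over `z`.
  have hfib : ∀ z, (((askedTriples S).filter fun e => e 0 = z).card : ℝ) ≤
      √(R.card : ℝ) * d z := by
    intro z
    have hinj : Set.InjOn (fun e : Fin 3 ↪ Fin N => (e 1, e 2))
        ((askedTriples S).filter fun e => e 0 = z) := by
      intro e he e' he' h
      simp only [coe_filter, Set.mem_ofPred_eq, Prod.mk.injEq] at he he' h
      ext k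
      fin_cases k
      · simp [he.2, he'.2]
      · simp [h.1]
      · simp [h.2]
    have h1 : ((askedTriples S).filter fun e => e 0 = z).card ≤ R.card := by
      refine card_le_card_of_injOn _ ?_ hinj
      intro e he
      simp only [askedTriples, coe_filter, mem_filter, mem_univ, true_and,
        Set.mem_ofPred_eq] at he
      exact (hA _ _).1 he.1.2.1
    have h2 : ((askedTriples S).filter fun e => e 0 = z).card ≤ d z * d z := by
      rw [hd, ← card_product]
      refine card_le_card_of_injOn _ ?_ hinj
      intro e he
      simp only [askedTriples, coe_filter, mem_filter, mem_univ, true_and,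
        Set.mem_ofPred_eq] at he
      simp only [coe_product, coe_filter, mem_univ, true_and, Set.mem_prod, Set.mem_ofPred_eq]
      obtain ⟨⟨ha, hb, hc⟩, rfl⟩ := he
      exact ⟨(hA _ _).1 ha, (hA _ _).1 hc⟩
    have h3 : (((askedTriples S).filter fun e => e 0 = z).card : ℝ) ^ 2 ≤
        (√(R.card : ℝ) * d z) ^ 2 := by
      rw [mul_pow, Real.sq_sqrt (by positivity), pow_two, pow_two]
      exact_mod_cast Nat.mul_le_mul h1 h2
    exact le_of_sq_le_sq h3 (by positivity)
  have htot : ((askedTriples S).card : ℝ) ≤ √(R.card : ℝ) * R.card := by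
    rw [card_eq_sum_card_fiberwise (f := fun e : Fin 3 ↪ Fin N => e 0) (t := univ) (by simp)]
    push_cast
    refine (sum_le_sum fun z _ => hfib z).trans ?_
    rw [← mul_sum, ← hdsum]
    push_cast
    exact le_rfl
  have h4 : ((askedTriples S).card : ℝ) ^ 2 ≤ (R.card : ℝ) ^ 3 := by
    calc _ ≤ (√(R.card : ℝ) * R.card) ^ 2 := by gcongr
      _ = _ := by rw [mul_pow, Real.sq_sqrt (by positivity)]; ring
  calc (askedTriples S).card ^ 2 ≤ R.card ^ 3 := by exact_mod_cast h4
    _ ≤ _ := Nat.pow_le_pow_left hRc 3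

end Triangles

/-! ### One-sided testers against a randomly labelled obstruction. -/

section Testers

variable {N : ℕ} {V : Type}

/-- `w` is a metric on `V`. -/
structure IsMetricOn (w : V → V → ℝ) : Prop where
  nonneg : ∀ u v, 0 ≤ w u v
  eq_zero_iff : ∀ u v, w u v = 0 ↔ u = v
  symm : ∀ u v, w u v = w v u
  triangle : ∀ u v t, w u v ≤ w u t + w v t

lemma IsMetricOn.isMetric {w : V → V → ℝ} (h : IsMetricOn w) (ψ : Fin N ≃ V) :
    IsMetric (labelled w ψ) where
  nonneg _ _ := h.nonneg _ _
  eq_zero_iff _ _ := (h.eq_zero_iff _ _).trans ψ.injective.eq_iff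
  symm _ _ := h.symm _ _
  triangle _ _ _ := h.triangle _ _ _

/-- `w` is a distance on `V`, and every part of it that contains none of the triangles in `T`
extends to a metric. -/
structure IsObstruction (w : V → V → ℝ) (T : Finset (Fin 3 ↪ V)) : Prop where
  nonneg : ∀ u v, 0 ≤ w u v
  symm : ∀ u v, w u v = w v u
  diag : ∀ u, w u u = 0
  extend : ∀ Q : V → V → Prop, (∀ u v, Q u v → Q v u) →
    (∀ t ∈ T, ¬ (Q (t 0) (t 1) ∧ Q (t 1) (t 2) ∧ Q (t 0) (t 2))) →
    ∃ w', IsMetricOn w' ∧ ∀ u v, Q u v → w' u v = w u v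

variable {w : V → V → ℝ} {T : Finset (Fin 3 ↪ V)}

lemma IsObstruction.isDistanceMatrix (h : IsObstruction w T) (ψ : Fin N ≃ V) :
    IsDistanceMatrix (labelled w ψ) where
  nonneg _ _ := h.nonneg _ _
  symm _ _ := h.symm _ _
  diag _ := h.diag _

lemma DecisionTree.output_congr (t : DecisionTree N) (M M' : Matrix (Fin N) (Fin N) ℝ)
    (h : ∀ p ∈ t.queries M, M p.1 p.2 = M' p.1 p.2) : t.output M' = t.output M := by
  induction t with
  | leaf r => rfl
  | query i j next ih =>
    simp only [DecisionTree.queries, List.mem_cons, forall_eq_or_imp] at h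
    simp only [DecisionTree.output]
    rw [← h.1]
    exact ih _ h.2

variable [DecidableEq V]

open Classical in
/-- Almost surely, a one-sided tester rejects only if its queries contain an obstruction. -/
lemma IsObstruction.ae_exists_of_reject (h : IsObstruction w T) (A : Tester N)
    (hA : A.IsOneSided) :
    ∀ᵐ ω ∂A.μ, ∀ ψ : Fin N ≃ V, (A.tree ω).output (labelled w ψ) = false →
      ∃ e ∈ askedTriples ((A.tree ω).queries (labelled w ψ)).toFinset,
        e.trans ψ.toEmbedding ∈ T := by
  -- The metric depends only on the labelling and the set of entries asked. There are finitely many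
  -- such pairs, so one null set covers every adaptive run. The zero matrix is a dummy for sets that
  -- contain an obstruction.
  have hex : ∀ (ψ : Fin N ≃ V) (S : Finset (Fin N × Fin N)), ∃ M,
      (¬ ∃ e ∈ askedTriples S, e.trans ψ.toEmbedding ∈ T) →
        IsMetric M ∧ ∀ i j, Asks S i j → M i j = labelled w ψ i j := by
    intro ψ S
    by_cases hS : ∃ e ∈ askedTriples S, e.trans ψ.toEmbedding ∈ T
    · exact ⟨0, fun hS' => (hS' hS).elim⟩
    · obtain ⟨w', hw', hag⟩ := h.extend (fun u v => Asks S (ψ.symm u) (ψ.symm v))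
        (fun u v => Asks.symm) (by
          intro t ht hQ
          refine hS ⟨t.trans ψ.symm.toEmbedding, ?_, ?_⟩
          · simpa [askedTriples] using hQ
          · convert ht
            ext k
            simp)
      refine ⟨labelled w' ψ, fun _ => ⟨hw'.isMetric ψ, fun i j hij => ?_⟩⟩
      exact hag _ _ (by simpa using hij)
  choose M hM using hex
  have hae : ∀ᵐ ω ∂A.μ, ∀ (ψ : Fin N ≃ V) (S : Finset (Fin N × Fin N)),
      (¬ ∃ e ∈ askedTriples S, e.trans ψ.toEmbedding ∈ T) →
        (A.tree ω).output (M ψ S) = true := by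
    rw [ae_all_iff]
    intro ψ
    rw [ae_all_iff]
    intro S
    by_cases hS : ∃ e ∈ askedTriples S, e.trans ψ.toEmbedding ∈ T
    · exact ae_of_all _ fun ω hS' => (hS' hS).elim
    · have hmet := (hM ψ S hS).1
      have h1 := hA _ hmet
      have hmeas := A.measurableSet_accept (M ψ S) ⟨hmet.nonneg, hmet.symm, fun i =>
        (hmet.eq_zero_iff i i).2 rfl⟩
      have h2 : A.μ {ω | (A.tree ω).output (M ψ S) = true} = 1 := by
        rw [Tester.acceptProb, measureReal_def] at h1
        rw [← ENNReal.ofReal_toReal (measure_ne_top A.μ _), h1, ENNReal.ofReal_one]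
      have h3 := (mem_ae_iff_prob_eq_one hmeas).2 h2
      filter_upwards [h3] with ω hω _ using hω
  filter_upwards [hae] with ω hω ψ hrej
  by_contra hno
  have h1 := hω ψ _ hno
  -- The run on the metric coincides with the run on the clique, hence it would reject a metric that
  -- is accepted.
  have h2 := (A.tree ω).output_congr (labelled w ψ)
    (M ψ ((A.tree ω).queries (labelled w ψ)).toFinset) (by
      rintro ⟨i, j⟩ hij
      exact ((hM ψ _ hno).2 i j (.inl (List.mem_toFinset.2 hij))).symm)
  rw [h1, hrej] at h2
  exact Bool.noConfusion h2

variable [Fintype V]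

-- The sum is the expected number of rejected inputs, so it suffices to bound this number for almost
-- every fixed decision tree (the easy direction of Yao's principle).
open Classical in
lemma Tester.sum_rejectProb_le {ι : Type*} [Fintype ι] (A : Tester N)
    (M : ι → Matrix (Fin N) (Fin N) ℝ) (hM : ∀ i, IsDistanceMatrix (M i)) (C : ℝ)
    (hC : ∀ᵐ ω ∂A.μ,
      ((univ.filter fun i => (A.tree ω).output (M i) = false).card : ℝ) ≤ C) :
    ∑ i, A.rejectProb (M i) ≤ C := by
  have hmeas : ∀ i, MeasurableSet {ω | (A.tree ω).output (M i) = false} := by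
    intro i
    convert (A.measurableSet_accept _ (hM i)).compl using 1
    ext ω
    simp
  have h1 : ∀ i, A.rejectProb (M i) =
      ∫ ω, ({ω | (A.tree ω).output (M i) = false}.indicator 1 ω : ℝ) ∂A.μ :=
    fun i => (integral_indicator_one (hmeas i)).symm
  have hint : ∀ i ∈ (univ : Finset ι), Integrable
      (fun ω => ({ω | (A.tree ω).output (M i) = false}.indicator 1 ω : ℝ)) A.μ :=
    fun i _ => (integrable_const (1 : ℝ)).indicator (hmeas i)
  rw [sum_congr rfl fun i _ => h1 i, ← integral_finsetSum _ hint]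
  calc _ ≤ ∫ _, C ∂A.μ := by
        refine integral_mono_ae (integrable_finsetSum _ hint) (integrable_const C) ?_
        filter_upwards [hC] with ω hω
        refine le_trans (le_of_eq ?_) hω
        simp [Set.indicator_apply, sum_boole]
    _ = C := by simp

/-- The query bound for adaptive algorithms. -/
theorem IsObstruction.adaptive_bound (h : IsObstruction w T) (A : Tester N)
    (hA : A.IsOneSided) (q : ℕ) (hq : A.MakesAtMost q) (hqN : 2 * q ≤ N)
    (hN : Nonempty (Fin N ≃ V))
    (hrej : 2 / 3 * (Fintype.card (Fin N ≃ V) : ℝ) ≤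
      ∑ ψ : Fin N ≃ V, A.rejectProb (labelled w ψ)) :
    2 / 3 * (N.descFactorial 3 : ℝ) ≤ (2 * q) ^ 3 * T.card := by
  classical
  obtain ⟨E, -, hE⟩ := exists_subset_card_eq (s := (univ : Finset (Fin N))) (n := 2 * q)
    (by simpa using hqN)
  set S : Finset (Fin 3 ↪ Fin N) := univ.filter fun e => ∀ k, e k ∈ E
  have hS : S.card ≤ (2 * q) ^ 3 := by
    rw [← hE, ← Fintype.card_coe E]
    have : S.card ≤ Fintype.card (Fin 3 → E) := by
      rw [← Fintype.card_coe S]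
      refine Fintype.card_le_of_injective
        (fun e k => (⟨e.1 k, (mem_filter.1 e.2).2 k⟩ : E)) ?_
      intro e e' hee
      ext k
      exact congrArg Fin.val (congrArg Subtype.val (congrFun hee k))
    simpa using this
  set P : Finset V → Prop := fun s => ∃ t ∈ T, ∀ k, t k ∈ s
  have hP : ∀ s t : Finset V, s ⊆ t → P s → P t := fun s s' hss ⟨t, ht, hk⟩ =>
    ⟨t, ht, fun k => hss (hk k)⟩
  have hsum := A.sum_rejectProb_le (fun ψ : Fin N ≃ V => labelled w ψ)
    (fun ψ => h.isDistanceMatrix ψ)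
    ((univ.filter fun ψ : Fin N ≃ V => ∃ e ∈ S, e.trans ψ.toEmbedding ∈ T).card : ℝ) (by
      filter_upwards [h.ae_exists_of_reject A hA] with ω hω
      obtain ⟨ψ₀⟩ := hN
      -- Nothing is revealed at the start. Rejection puts an obstruction among the labels of the
      -- touched indices, and this monotone event is transferred to the fixed set `E`.
      have key := card_explored_le w P hP (A.tree ω) ∅ E ψ₀ q (disjoint_empty_left _) hE
        fun ψ _ => hq _ (h.isDistanceMatrix ψ) ω
      simp only [notMem_empty, false_imp_iff, implies_true, true_and, empty_union] at key
      refine Nat.cast_le.2 ((card_le_card ?_).trans (key.trans (card_le_card ?_)))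
      · intro ψ hψ
        simp only [mem_filter, mem_univ, true_and] at hψ ⊢
        obtain ⟨e, he, heT⟩ := hω ψ hψ
        refine ⟨_, heT, fun k => mem_image_of_mem _ ?_⟩
        have hl : ∀ i j, Asks ((A.tree ω).queries (labelled w ψ)).toFinset i j →
            i ∈ touched ((A.tree ω).queries (labelled w ψ)) ∧
            j ∈ touched ((A.tree ω).queries (labelled w ψ)) := by
          intro i j hij
          simp only [Asks, List.mem_toFinset] at hij
          simp only [touched, mem_union, List.mem_toFinset, List.mem_map]
          rcases hij with hij | hij
          · exact ⟨.inl ⟨_, hij, rfl⟩, .inr ⟨_, hij, rfl⟩⟩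
          · exact ⟨.inr ⟨_, hij, rfl⟩, .inl ⟨_, hij, rfl⟩⟩
        simp only [askedTriples, mem_filter, mem_univ, true_and] at he
        fin_cases k
        · exact (hl _ _ he.1).1
        · exact (hl _ _ he.1).2
        · exact (hl _ _ he.2.1).2
      · intro ψ hψ
        simp only [mem_filter, mem_univ, true_and] at hψ ⊢
        obtain ⟨t, ht, hk⟩ := hψ
        refine ⟨t.trans ψ.symm.toEmbedding, ?_, ?_⟩
        · refine mem_filter.2 ⟨mem_univ _, fun k => ?_⟩
          obtain ⟨i, hi, hik⟩ := mem_image.1 (hk k)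
          simpa [← hik] using hi
        · convert ht
          ext k
          simp)
  have hcount := card_labelling_exists_triple_mul_le hN T S
  have hpos : (0 : ℝ) < Fintype.card (Fin N ≃ V) := by
    exact_mod_cast Fintype.card_pos_iff.2 hN
  have hcount' : ((univ.filter fun ψ : Fin N ≃ V => ∃ e ∈ S, e.trans ψ.toEmbedding ∈ T).card : ℝ) *
      N.descFactorial 3 ≤ (2 * q) ^ 3 * T.card * Fintype.card (Fin N ≃ V) := by
    have : (S.card : ℝ) ≤ (2 * q) ^ 3 := by exact_mod_cast hS
    calc _ ≤ (S.card : ℝ) * T.card * Fintype.card (Fin N ≃ V) := by exact_mod_cast hcount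
      _ ≤ _ := by gcongr
  refine le_of_mul_le_mul_right ?_ hpos
  calc _ = 2 / 3 * (Fintype.card (Fin N ≃ V) : ℝ) * N.descFactorial 3 := by ring
    _ ≤ _ := mul_le_mul_of_nonneg_right (hrej.trans hsum) (by positivity)
    _ ≤ _ := hcount'

/-- The query bound for non-adaptive algorithms. -/
theorem IsObstruction.nonadaptive_bound (h : IsObstruction w T) (A : Tester N)
    (hA : A.IsOneSided) (q : ℕ) (hq : A.MakesAtMost q) (hna : A.IsNonadaptive)
    (hN : Nonempty (Fin N ≃ V))
    (hrej : 2 / 3 * (Fintype.card (Fin N ≃ V) : ℝ) ≤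
      ∑ ψ : Fin N ≃ V, A.rejectProb (labelled w ψ)) :
    (2 / 3 * (N.descFactorial 3 : ℝ)) ^ 2 ≤ (2 * q) ^ 3 * (T.card : ℝ) ^ 2 := by
  classical
  have hpos : (0 : ℝ) < Fintype.card (Fin N ≃ V) := by
    exact_mod_cast Fintype.card_pos_iff.2 hN
  -- For `N < 3` there are no triples and the later division would be by zero.
  rcases Nat.eq_zero_or_pos (N.descFactorial 3) with h0 | h0
  · rw [h0]
    simp only [Nat.cast_zero, mul_zero, zero_pow two_ne_zero]
    positivity
  have hd : (0 : ℝ) < N.descFactorial 3 := by exact_mod_cast h0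
  set B : ℝ := √((2 * q) ^ 3) with hB
  have hsum := A.sum_rejectProb_le (fun ψ : Fin N ≃ V => labelled w ψ)
    (fun ψ => h.isDistanceMatrix ψ)
    (B * T.card * Fintype.card (Fin N ≃ V) / N.descFactorial 3) (by
      filter_upwards [h.ae_exists_of_reject A hA] with ω hω
      obtain ⟨ψ₀⟩ := id hN
      -- Non-adaptivity makes the query set the same for all labellings, so it may be read off at
      -- `ψ₀` and a plain union bound applies.
      set S := askedTriples ((A.tree ω).queries (labelled w ψ₀)).toFinset with hS
      have hcount := card_labelling_exists_triple_mul_le hN T S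
      have hSB : (S.card : ℝ) ≤ B := by
        refine Real.le_sqrt_of_sq_le ?_
        have h1 := card_askedTriples_sq_le ((A.tree ω).queries (labelled w ψ₀)).toFinset
        have h2 : (2 * ((A.tree ω).queries (labelled w ψ₀)).toFinset.card) ^ 3 ≤
            (2 * q) ^ 3 := by
          gcongr
          exact (List.toFinset_card_le _).trans (hq _ (h.isDistanceMatrix ψ₀) ω)
        exact_mod_cast h1.trans h2
      rw [le_div_iff₀ hd]
      calc _ ≤ ((univ.filter fun ψ : Fin N ≃ V =>
              ∃ e ∈ S, e.trans ψ.toEmbedding ∈ T).card : ℝ) * N.descFactorial 3 := by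
            gcongr with ψ
            intro hψ
            rw [hS, hna ω _ _ (h.isDistanceMatrix ψ₀) (h.isDistanceMatrix ψ)]
            exact hω ψ hψ
        _ ≤ (S.card : ℝ) * T.card * Fintype.card (Fin N ≃ V) := by exact_mod_cast hcount
        _ ≤ _ := by gcongr)
  have hle : 2 / 3 * (N.descFactorial 3 : ℝ) ≤ B * T.card := by
    have := hrej.trans hsum
    rw [le_div_iff₀ hd] at this
    refine le_of_mul_le_mul_right ?_ hpos
    linarith
  calc _ ≤ (B * T.card) ^ 2 := by gcongr
    _ = _ := by rw [mul_pow, hB, Real.sq_sqrt (by positivity)]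

end Testers

end MetricTesting

namespace MetricTesting

open Finset

/-! ### The weighted clique: violating triangles, repairs and padding. -/

section Clique

variable {n : ℕ}

/-- The vertex of type `A` with label `i`. -/
abbrev aVertex (i : ZMod n) : Vertex n := .inl i

/-- The vertex of type `B` with label `i`. -/
abbrev bVertex (i : ZMod n) : Vertex n := .inr (.inl i)

/-- The vertex of type `C` with label `i`. -/
abbrev cVertex (i : ZMod n) : Vertex n := .inr (.inr i)

/-- The bounds, depending only on the types of the vertices, for the weights of the clique. -/
structure HasCliqueBounds (d : Vertex n → Vertex n → ℝ) : Prop where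
  symm : ∀ u v, d u v = d v u
  diag : ∀ u, d u u = 0
  aa : ∀ i j, i ≠ j → d (aVertex i) (aVertex j) = 2
  bb : ∀ i j, i ≠ j → d (bVertex i) (bVertex j) = 2
  cc : ∀ i j, i ≠ j → d (cVertex i) (cVertex j) = 2
  ab : ∀ i j, 1 ≤ d (aVertex i) (bVertex j) ∧ d (aVertex i) (bVertex j) ≤ 2
  bc : ∀ i j, 2 ≤ d (bVertex i) (cVertex j) ∧ d (bVertex i) (cVertex j) ≤ 3
  ac : ∀ i j, 2 ≤ d (aVertex i) (cVertex j) ∧ d (aVertex i) (cVertex j) ≤ 4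

namespace HasCliqueBounds

variable {d : Vertex n → Vertex n → ℝ} (h : HasCliqueBounds d)

include h

lemma one_le {u v : Vertex n} (huv : u ≠ v) : 1 ≤ d u v := by
  rcases u with i | i | i <;> rcases v with j | j | j
  · linarith [h.aa i j fun e => huv (by rw [e])]
  · linarith [(h.ab i j).1]
  · linarith [(h.ac i j).1]
  · linarith [(h.ab j i).1, h.symm (aVertex j) (bVertex i)]
  · linarith [h.bb i j fun e => huv (by rw [e])]
  · linarith [(h.bc i j).1]
  · linarith [(h.ac j i).1, h.symm (aVertex j) (cVertex i)]
  · linarith [(h.bc j i).1, h.symm (bVertex j) (cVertex i)]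
  · linarith [h.cc i j fun e => huv (by rw [e])]

lemma nonneg (u v : Vertex n) : 0 ≤ d u v := by
  by_cases huv : u = v
  · rw [huv, h.diag]
  · linarith [h.one_le huv]

lemma le_four (u v : Vertex n) : d u v ≤ 4 := by
  by_cases huv : u = v
  · rw [huv, h.diag]
    norm_num
  rcases u with i | i | i <;> rcases v with j | j | j
  · linarith [h.aa i j fun e => huv (by rw [e])]
  · linarith [(h.ab i j).2]
  · linarith [(h.ac i j).2]
  · linarith [(h.ab j i).2, h.symm (aVertex j) (bVertex i)]
  · linarith [h.bb i j fun e => huv (by rw [e])]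
  · linarith [(h.bc i j).2]
  · linarith [(h.ac j i).2, h.symm (aVertex j) (cVertex i)]
  · linarith [(h.bc j i).2, h.symm (bVertex j) (cVertex i)]
  · linarith [h.cc i j fun e => huv (by rw [e])]

/-- A triangle inequality can fail only for the path from `A` to `C` through `B`. -/
lemma triangle_or (u v t : Vertex n) : d u t ≤ d u v + d v t ∨
    (∃ i j k, u = aVertex i ∧ v = bVertex j ∧ t = cVertex k) ∨
    (∃ i j k, t = aVertex i ∧ v = bVertex j ∧ u = cVertex k) := by
  by_cases huv : u = v
  · left
    rw [huv, h.diag, zero_add]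
  by_cases hvt : v = t
  · left
    rw [hvt, h.diag, add_zero]
  by_cases hut : u = t
  · left
    rw [hut, h.diag]
    exact add_nonneg (h.nonneg _ _) (h.nonneg _ _)
  -- Two sides total at least 2, which settles a third side of weight at most 2. Against a `BC`
  -- side, at most 3, one of the others is at least 2. Against an `AC` side, at most 4, both are at
  -- least 2 unless the middle vertex is in `B`.
  have h1 := h.one_le huv
  have h2 := h.one_le hvt
  rcases u with i | i | i <;> rcases t with k | k | k
  · left
    linarith [h.aa i k fun e => hut (by rw [e])]
  · left
    linarith [(h.ab i k).2]
  · rcases v with j | j | j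
    · left
      linarith [(h.ac i k).2, h.aa i j fun e => huv (by rw [e]), (h.ac j k).1]
    · exact .inr (.inl ⟨i, j, k, rfl, rfl, rfl⟩)
    · left
      linarith [(h.ac i k).2, h.cc j k fun e => hvt (by rw [e]), (h.ac i j).1]
  · left
    linarith [(h.ab k i).2, h.symm (aVertex k) (bVertex i)]
  · left
    linarith [h.bb i k fun e => hut (by rw [e])]
  · left
    rcases v with j | j | j
    · linarith [(h.bc i k).2, (h.ac j k).1]
    · linarith [(h.bc i k).2, (h.bc j k).1]
    · linarith [(h.bc i k).2, (h.bc i j).1]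
  · rcases v with j | j | j
    · left
      linarith [(h.ac k i).2, h.aa j k fun e => hvt (by rw [e]), (h.ac j i).1,
        h.symm (aVertex k) (cVertex i), h.symm (aVertex j) (cVertex i)]
    · exact .inr (.inr ⟨k, j, i, rfl, rfl, rfl⟩)
    · left
      linarith [(h.ac k i).2, h.cc i j fun e => huv (by rw [e]), (h.ac k j).1,
        h.symm (aVertex k) (cVertex i), h.symm (aVertex k) (cVertex j)]
  · left
    have h3 := (h.bc k i).2
    rw [h.symm] at h3
    rcases v with j | j | j
    · linarith [(h.ac j i).1, h.symm (aVertex j) (cVertex i)]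
    · linarith [(h.bc j i).1, h.symm (bVertex j) (cVertex i)]
    · linarith [(h.bc k j).1, h.symm (bVertex k) (cVertex j)]
  · left
    linarith [h.cc i k fun e => hut (by rw [e])]

lemma isMetricOn (habc : ∀ i j k, d (aVertex i) (cVertex k) ≤
    d (aVertex i) (bVertex j) + d (bVertex j) (cVertex k)) : IsMetricOn d where
  nonneg := h.nonneg
  eq_zero_iff u v := by
    refine ⟨fun h0 => ?_, fun e => e ▸ h.diag u⟩
    by_contra huv
    linarith [h.one_le huv]
  symm := h.symm
  triangle u v t := by
    rw [h.symm v t]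
    rcases h.triangle_or u t v with h1 | ⟨i, j, k, rfl, rfl, rfl⟩ | ⟨i, j, k, rfl, rfl, rfl⟩
    · exact h1
    · exact habc i j k
    · rw [h.symm, add_comm, h.symm (bVertex j), h.symm (cVertex k)]
      exact habc i j k

end HasCliqueBounds

variable (X : Finset (ZMod n))

lemma weight_symm (u v : Vertex n) : weight X u v = weight X v u := by
  rcases u with i | i | i <;> rcases v with j | j | j <;> simp [weight, eq_comm]

lemma hasCliqueBounds_weight : HasCliqueBounds (weight X) where
  symm := weight_symm X
  diag u := by rcases u with i | i | i <;> simp [weight]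
  aa i j hij := by simp [weight, hij]
  bb i j hij := by simp [weight, hij]
  cc i j hij := by simp [weight, hij]
  ab i j := by
    simp only [weight]
    split_ifs <;> norm_num
  bc i j := by
    simp only [weight]
    split_ifs <;> norm_num
  ac i j := by
    simp only [weight]
    split_ifs <;> norm_num

/-- The harmless weights that only depend on the types of the vertices. -/
def capWeight : Vertex n → Vertex n → ℝ
  | .inl _, .inr (.inl _) => 2
  | .inr (.inl _), .inl _ => 2
  | .inl _, .inr (.inr _) => 3
  | .inr (.inr _), .inl _ => 3
  | .inr (.inl _), .inr (.inr _) => 3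
  | .inr (.inr _), .inr (.inl _) => 3
  | .inl i, .inl j => weight ∅ (aVertex i) (aVertex j)
  | .inr (.inl i), .inr (.inl j) => weight ∅ (bVertex i) (bVertex j)
  | .inr (.inr i), .inr (.inr j) => weight ∅ (cVertex i) (cVertex j)

open Classical in
/-- The weights of the clique with all those outside `Q` made harmless. -/
noncomputable def cappedWeight (Q : Vertex n → Vertex n → Prop) (u v : Vertex n) : ℝ :=
  if Q u v then weight X u v else capWeight u v

lemma hasCliqueBounds_cappedWeight (Q : Vertex n → Vertex n → Prop)
    (hQ : ∀ u v, Q u v → Q v u) : HasCliqueBounds (cappedWeight X Q) where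
  symm u v := by
    have h1 : Q u v ↔ Q v u := ⟨hQ u v, hQ v u⟩
    have h2 : capWeight u v = capWeight v u := by
      rcases u with i | i | i <;> rcases v with j | j | j <;> simp [capWeight, weight, eq_comm]
    by_cases h : Q u v <;> simp [cappedWeight, h, ← h1, h2, weight_symm X u v]
  diag u := by rcases u with i | i | i <;> simp [cappedWeight, capWeight, weight]
  aa i j hij := by simp [cappedWeight, capWeight, weight, hij]
  bb i j hij := by simp [cappedWeight, capWeight, weight, hij]
  cc i j hij := by simp [cappedWeight, capWeight, weight, hij]
  ab i j := by
    simp only [cappedWeight, capWeight]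
    split_ifs
    · exact (hasCliqueBounds_weight X).ab i j
    · norm_num
  bc i j := by
    simp only [cappedWeight, capWeight]
    split_ifs
    · exact (hasCliqueBounds_weight X).bc i j
    · norm_num
  ac i j := by
    simp only [cappedWeight, capWeight]
    split_ifs
    · exact (hasCliqueBounds_weight X).ac i j
    · norm_num

lemma weight_ab (i x : ZMod n) (hx : x ∈ X) : weight X (aVertex i) (bVertex (i + x)) = 1 := by
  simp [weight, hx]

lemma weight_bc (i x : ZMod n) (hx : x ∈ X) :
    weight X (bVertex (i + x)) (cVertex (i + x + x)) = 2 := by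
  simp [weight, hx]

lemma weight_ac (i x : ZMod n) (hx : x ∈ X) :
    weight X (aVertex i) (cVertex (i + x + x)) = 4 := by
  simp only [weight]
  rw [if_pos ⟨x, hx, by ring⟩]

variable {X}

/-- The paths `A`, `B`, `C` that violate the triangle inequality, if `X` is 3-AP-free. -/
lemma exists_of_weight_lt (hX : ThreeAPFree (X : Set (ZMod n))) (i j k : ZMod n)
    (h : weight X (aVertex i) (bVertex j) + weight X (bVertex j) (cVertex k) <
      weight X (aVertex i) (cVertex k)) : ∃ x ∈ X, j = i + x ∧ k = i + x + x := by
  simp only [weight] at h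
  -- Of all combinations only `1 + 2 < 4` is a violation.
  split_ifs at h with h1 h2 h3 <;> try norm_num at h
  obtain ⟨y, hy, hy'⟩ := h1
  obtain ⟨z, hz, hz'⟩ := h2
  obtain ⟨x, hx, hx'⟩ := h3
  have h4 : y + z = x + x := by
    rw [← hy', ← hz', ← two_mul, ← hx']
    ring
  obtain rfl : y = x := hX hy hx hz h4
  refine ⟨y, hy, by rw [← hy']; ring, ?_⟩
  rw [add_assoc, ← two_mul, ← hx']
  ring

/-- A single capped edge already rescues an `A`, `B`, `C` path: `3 ≤ 1 + 2`, `4 ≤ 2 + 2` and `4 ≤ 1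
+ 3`. A violation therefore needs all three edges in `Q`. -/
lemma isMetricOn_cappedWeight (hX : ThreeAPFree (X : Set (ZMod n)))
    (Q : Vertex n → Vertex n → Prop) (hQ : ∀ u v, Q u v → Q v u)
    (h : ∀ i, ∀ x ∈ X, ¬ (Q (aVertex i) (bVertex (i + x)) ∧
      Q (bVertex (i + x)) (cVertex (i + x + x)) ∧ Q (aVertex i) (cVertex (i + x + x)))) :
    IsMetricOn (cappedWeight X Q) := by
  have hb := hasCliqueBounds_cappedWeight X Q hQ
  have hw := hasCliqueBounds_weight X
  refine hb.isMetricOn fun i j k => ?_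
  have h1 := hb.ab i j
  have h2 := hb.bc j k
  have h3 := hb.ac i k
  by_cases q3 : Q (aVertex i) (cVertex k)
  · by_cases q1 : Q (aVertex i) (bVertex j)
    · by_cases q2 : Q (bVertex j) (cVertex k)
      · simp only [cappedWeight, q1, q2, q3, if_true]
        by_contra! hlt
        obtain ⟨x, hx, rfl, rfl⟩ := exists_of_weight_lt hX i j k hlt
        exact h i x hx ⟨q1, q2, q3⟩
      · have : cappedWeight X Q (bVertex j) (cVertex k) = 3 := by
          simp [cappedWeight, capWeight, q2]
        linarith
    · have : cappedWeight X Q (aVertex i) (bVertex j) = 2 := by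
        simp [cappedWeight, capWeight, q1]
      linarith
  · have : cappedWeight X Q (aVertex i) (cVertex k) = 3 := by
      simp [cappedWeight, capWeight, q3]
    linarith

/-- The vertices of the violating triangle given by a label and a difference. -/
def triple (p : ZMod n × ZMod n) : Fin 3 ↪ Vertex n where
  toFun := ![aVertex p.1, bVertex (p.1 + p.2), cVertex (p.1 + p.2 + p.2)]
  inj' := by
    intro k l h
    fin_cases k <;> fin_cases l <;> simp_all

/-- The edges of a violating triangle, directed from `A` to `B` to `C`. -/
def IsEdge (p : ZMod n × ZMod n) (u v : Vertex n) : Prop :=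
  (u = aVertex p.1 ∧ v = bVertex (p.1 + p.2)) ∨
  (u = bVertex (p.1 + p.2) ∧ v = cVertex (p.1 + p.2 + p.2)) ∨
  (u = aVertex p.1 ∧ v = cVertex (p.1 + p.2 + p.2))

/-- An `AC` edge yields only `x + x = y + y`, and doubling need not be injective modulo `n`; the
degenerate case of 3-AP-freeness gives `x = y`. -/
lemma IsEdge.unique (hX : ThreeAPFree (X : Set (ZMod n))) {p p' : ZMod n × ZMod n}
    (hp : p.2 ∈ X) (hp' : p'.2 ∈ X) {u v : Vertex n} (h : IsEdge p u v) (h' : IsEdge p' u v) :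
    p = p' := by
  obtain ⟨i, x⟩ := p
  obtain ⟨j, y⟩ := p'
  rcases h with ⟨rfl, rfl⟩ | ⟨rfl, rfl⟩ | ⟨rfl, rfl⟩ <;>
    rcases h' with ⟨h1, h2⟩ | ⟨h1, h2⟩ | ⟨h1, h2⟩ <;>
    simp only [Sum.inl.injEq, Sum.inr.injEq, reduceCtorEq] at h1 h2
  · subst h1
    rw [add_left_cancel h2]
  · rw [h1] at h2
    obtain rfl := add_left_cancel h2
    rw [add_right_cancel h1]
  · subst h1
    rw [add_assoc, add_assoc] at h2
    obtain rfl : x = y := hX hp hp' hp (add_left_cancel h2)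
    rfl

lemma IsEdge.not_swap {p p' : ZMod n × ZMod n} {u v : Vertex n} (h : IsEdge p u v)
    (h' : IsEdge p' v u) : False := by
  rcases h with ⟨rfl, rfl⟩ | ⟨rfl, rfl⟩ | ⟨rfl, rfl⟩ <;>
    rcases h' with ⟨h1, h2⟩ | ⟨h1, h2⟩ | ⟨h1, h2⟩ <;>
    simp only [Sum.inr.injEq, reduceCtorEq] at h1 h2

/-- The vertex set of a violating triangle. -/
def triangle (p : ZMod n × ZMod n) : Finset (Vertex n) :=
  {aVertex p.1, bVertex (p.1 + p.2), cVertex (p.1 + p.2 + p.2)}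

lemma isEdge_or_of_mem_triangle {p : ZMod n × ZMod n} {u v : Vertex n} (hu : u ∈ triangle p)
    (hv : v ∈ triangle p) (huv : u ≠ v) : IsEdge p u v ∨ IsEdge p v u := by
  simp only [triangle, mem_insert, mem_singleton] at hu hv
  rcases hu with rfl | rfl | rfl <;> rcases hv with rfl | rfl | rfl <;>
    first
      | exact (huv rfl).elim
      | simp [IsEdge]

lemma isViolatingTriangle_iff (hX : ThreeAPFree (X : Set (ZMod n))) (s : Finset (Vertex n)) :
    IsViolatingTriangle (weight X) s ↔ ∃ p : ZMod n × ZMod n, p.2 ∈ X ∧ triangle p = s := by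
  constructor
  · rintro ⟨u, v, t, -, -, -, rfl, hlt⟩
    rcases (hasCliqueBounds_weight X).triangle_or u v t with h | ⟨i, j, k, rfl, rfl, rfl⟩ |
      ⟨i, j, k, rfl, rfl, rfl⟩
    · exact absurd h (not_le.2 hlt)
    · obtain ⟨x, hx, rfl, rfl⟩ := exists_of_weight_lt hX i j k hlt
      exact ⟨(i, x), hx, rfl⟩
    · rw [add_comm, weight_symm X (bVertex j), weight_symm X (cVertex k),
        weight_symm X (cVertex k)] at hlt
      obtain ⟨x, hx, rfl, rfl⟩ := exists_of_weight_lt hX i j k hlt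
      refine ⟨(i, x), hx, ?_⟩
      ext z
      simp only [triangle, mem_insert, mem_singleton]
      tauto
  · rintro ⟨⟨i, x⟩, hx, rfl⟩
    refine ⟨aVertex i, bVertex (i + x), cVertex (i + x + x), by simp, by simp, by simp, rfl, ?_⟩
    rw [weight_ab X i x hx, weight_bc X i x hx, weight_ac X i x hx]
    norm_num

lemma triangle_injOn (hX : ThreeAPFree (X : Set (ZMod n))) :
    Set.InjOn triangle {p : ZMod n × ZMod n | p.2 ∈ X} := by
  intro p hp p' hp' h
  have h1 : aVertex p.1 ∈ triangle p := by simp [triangle]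
  have h2 : bVertex (p.1 + p.2) ∈ triangle p := by simp [triangle]
  rw [h] at h1 h2
  rcases isEdge_or_of_mem_triangle h1 h2 (by simp) with h3 | h3
  · exact IsEdge.unique hX hp hp' (.inl ⟨rfl, rfl⟩) h3
  · exact (IsEdge.not_swap (p := p) (.inl ⟨rfl, rfl⟩) h3).elim

lemma ncard_isViolatingTriangle [NeZero n] (hX : ThreeAPFree (X : Set (ZMod n))) :
    {s : Finset (Vertex n) | IsViolatingTriangle (weight X) s}.ncard = n * X.card := by
  have h1 : {s : Finset (Vertex n) | IsViolatingTriangle (weight X) s} =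
      triangle '' {p : ZMod n × ZMod n | p.2 ∈ X} := by
    ext s
    exact isViolatingTriangle_iff hX s
  have h2 : {p : ZMod n × ZMod n | p.2 ∈ X} =
      ((univ ×ˢ X : Finset (ZMod n × ZMod n)) : Set (ZMod n × ZMod n)) := by
    ext p
    simp
  rw [h1, (triangle_injOn hX).ncard_image, h2, Set.ncard_coe_finset, card_product,
    card_univ, ZMod.card]

/-- Two common vertices would span a common edge, and an edge determines its triangle. -/
lemma card_inter_le_one (hX : ThreeAPFree (X : Set (ZMod n))) (s s' : Finset (Vertex n))
    (hs : IsViolatingTriangle (weight X) s) (hs' : IsViolatingTriangle (weight X) s')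
    (hne : s ≠ s') : (s ∩ s').card ≤ 1 := by
  obtain ⟨p, hp, rfl⟩ := (isViolatingTriangle_iff hX s).1 hs
  obtain ⟨p', hp', rfl⟩ := (isViolatingTriangle_iff hX s').1 hs'
  by_contra! hlt
  obtain ⟨u, hu, v, hv, huv⟩ := one_lt_card.1 hlt
  rw [mem_inter] at hu hv
  refine hne (congrArg triangle ?_)
  rcases isEdge_or_of_mem_triangle hu.1 hv.1 huv with h | h <;>
    rcases isEdge_or_of_mem_triangle hu.2 hv.2 huv with h' | h'
  · exact h.unique hX hp hp' h'
  · exact (h.not_swap h').elim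
  · exact (h.not_swap h').elim
  · exact h.unique hX hp hp' h'

/-- A metric differs from a matrix that contains the clique in at least two entries for each
violating triangle. -/
lemma two_mul_le_entryDist [NeZero n] (hX : ThreeAPFree (X : Set (ZMod n))) {N : ℕ}
    (φ : Vertex n ↪ Fin N) (M M' : Matrix (Fin N) (Fin N) ℝ) (hM' : IsMetric M')
    (hM : ∀ u v, M (φ u) (φ v) = weight X u v) : 2 * n * X.card ≤ entryDist M M' := by
  -- A metric cannot keep the weights 1, 2, 4, so every triangle has an altered edge. These edges
  -- are distinct, and each counts in both orders, recorded by a `Bool`.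
  have hex : ∀ p : (univ ×ˢ X : Finset (ZMod n × ZMod n)), ∃ uv : Vertex n × Vertex n,
      IsEdge p.1 uv.1 uv.2 ∧ M (φ uv.1) (φ uv.2) ≠ M' (φ uv.1) (φ uv.2) := by
    rintro ⟨⟨i, x⟩, hp⟩
    have hx : x ∈ X := (mem_product.1 hp).2
    by_contra! hno
    have h1 := hno (aVertex i, bVertex (i + x)) (.inl ⟨rfl, rfl⟩)
    have h2 := hno (bVertex (i + x), cVertex (i + x + x)) (.inr (.inl ⟨rfl, rfl⟩))
    have h3 := hno (aVertex i, cVertex (i + x + x)) (.inr (.inr ⟨rfl, rfl⟩))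
    rw [hM, weight_ab X i x hx] at h1
    rw [hM, weight_bc X i x hx] at h2
    rw [hM, weight_ac X i x hx] at h3
    have h4 := hM'.triangle (φ (aVertex i)) (φ (cVertex (i + x + x))) (φ (bVertex (i + x)))
    rw [hM'.symm (φ (cVertex (i + x + x)))] at h4
    simp only at h1 h2 h3
    linarith
  choose e he1 he2 using hex
  have hcard : 2 * n * X.card =
      Fintype.card ((univ ×ˢ X : Finset (ZMod n × ZMod n)) × Bool) := by
    rw [Fintype.card_prod, Fintype.card_coe, card_product, card_univ, ZMod.card,
      Fintype.card_bool]
    ring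
  rw [hcard, entryDist, ← card_univ]
  refine card_le_card_of_injOn (fun a => if a.2 then (φ (e a.1).1, φ (e a.1).2) else
    (φ (e a.1).2, φ (e a.1).1)) ?_ ?_
  · have hsymm : ∀ u v, M (φ u) (φ v) = M (φ v) (φ u) := fun u v => by
      rw [hM, hM, weight_symm]
    rintro ⟨p, β⟩ -
    cases β
    · simpa [hM'.symm (φ (e p).2), hsymm (e p).2] using he2 p
    · simpa using he2 p
  · have hX' : ∀ p : (univ ×ˢ X : Finset (ZMod n × ZMod n)), p.1.2 ∈ X := fun p =>
      (mem_product.1 p.2).2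
    rintro ⟨p, β⟩ - ⟨p', β'⟩ - h
    have h5 := he1 p'
    cases β <;> cases β' <;>
      simp only [Bool.false_eq_true, if_false, if_true, Prod.mk.injEq, φ.injective.eq_iff] at h <;>
      rw [← h.1, ← h.2] at h5
    · rw [Subtype.ext ((he1 p).unique hX (hX' p) (hX' p') h5)]
    · exact ((he1 p).not_swap h5).elim
    · exact ((he1 p).not_swap h5).elim
    · rw [Subtype.ext ((he1 p).unique hX (hX' p) (hX' p') h5)]

/-- Weight 4 occurs only on the `AC` edges of violating triangles, once in each; capping exactly
these to 3 gives a metric that attains the lower bound. -/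
lemma isLeast_entryDist [NeZero n] (hX : ThreeAPFree (X : Set (ZMod n)))
    (ψ : Fin (3 * n) ≃ Vertex n) :
    IsLeast {k : ℕ | ∃ M' : Matrix (Fin (3 * n)) (Fin (3 * n)) ℝ,
      IsMetric M' ∧ entryDist (cliqueMatrix X ψ) M' = k} (2 * n * X.card) := by
  have hlow : ∀ M', IsMetric M' → 2 * n * X.card ≤ entryDist (cliqueMatrix X ψ) M' :=
    fun M' hM' => two_mul_le_entryDist hX ψ.symm.toEmbedding _ M' hM'
      (by intro u v; simp [cliqueMatrix])
  refine ⟨?_, ?_⟩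
  · have hmet := isMetricOn_cappedWeight hX (fun u v => weight X u v ≠ 4)
      (fun u v h => by rwa [weight_symm]) (fun i x hx h => h.2.2 (weight_ac X i x hx))
    refine ⟨_, hmet.isMetric ψ, le_antisymm ?_ (hlow _ (hmet.isMetric ψ))⟩
    have hcard : 2 * n * X.card = ((univ ×ˢ X) ×ˢ (univ : Finset Bool) :
        Finset ((ZMod n × ZMod n) × Bool)).card := by
      rw [card_product, card_product, card_univ, ZMod.card, card_univ, Fintype.card_bool]
      ring
    rw [hcard, entryDist]
    refine (card_le_card ?_).trans (card_image_le (f := fun a : (ZMod n × ZMod n) × Bool =>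
      if a.2 then (ψ.symm (aVertex a.1.1), ψ.symm (cVertex (a.1.1 + a.1.2 + a.1.2))) else
        (ψ.symm (cVertex (a.1.1 + a.1.2 + a.1.2)), ψ.symm (aVertex a.1.1))))
    rintro ⟨k, l⟩ hkl
    simp only [cliqueMatrix, labelled, cappedWeight] at hkl
    have h4 : weight X (ψ k) (ψ l) = 4 := by
      by_contra h4
      simp [h4] at hkl
    obtain ⟨u, rfl⟩ := ψ.symm.surjective k
    obtain ⟨v, rfl⟩ := ψ.symm.surjective l
    simp only [Equiv.apply_symm_apply] at h4
    have key : ∀ i j, weight X (aVertex i) (cVertex j) = 4 → ∃ x ∈ X, j = i + x + x := by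
      intro i j h
      simp only [weight] at h
      split_ifs at h with hx
      · obtain ⟨x, hx, hx'⟩ := hx
        refine ⟨x, hx, ?_⟩
        rw [add_assoc, ← two_mul, ← hx']
        ring
      · norm_num at h
    have hw := hasCliqueBounds_weight X
    by_cases huv : u = v
    · rw [huv, hw.diag] at h4
      norm_num at h4
    rw [mem_image]
    rcases u with i | i | i <;> rcases v with j | j | j
    · linarith [hw.aa i j fun e => huv (by rw [e])]
    · linarith [(hw.ab i j).2]
    · obtain ⟨x, hx, rfl⟩ := key i j h4
      exact ⟨((i, x), true), by simp [hx], by simp⟩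
    · linarith [(hw.ab j i).2, hw.symm (aVertex j) (bVertex i)]
    · linarith [hw.bb i j fun e => huv (by rw [e])]
    · linarith [(hw.bc i j).2]
    · obtain ⟨x, hx, rfl⟩ := key j i (by rw [weight_symm]; exact h4)
      exact ⟨((j, x), false), by simp [hx], by simp⟩
    · linarith [(hw.bc j i).2, hw.symm (bVertex j) (cVertex i)]
    · linarith [hw.cc i j fun e => huv (by rw [e])]
  · rintro k ⟨M', hM', rfl⟩
    exact hlow M' hM'

/-- The violating triangles, as triples of vertices. -/
def triples [NeZero n] (X : Finset (ZMod n)) : Finset (Fin 3 ↪ Vertex n) := by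
  classical exact (univ ×ˢ X).image triple

lemma card_triples_le [NeZero n] (X : Finset (ZMod n)) : (triples X).card ≤ n * X.card := by
  refine card_image_le.trans (le_of_eq ?_)
  rw [card_product, card_univ, ZMod.card]

/-- The bound 4 is kept because padding points lie at distance 2, so a detour through one costs 4.
-/
lemma exists_bounded_extension [NeZero n] (hX : ThreeAPFree (X : Set (ZMod n)))
    (Q : Vertex n → Vertex n → Prop) (hQ : ∀ u v, Q u v → Q v u)
    (h : ∀ t ∈ triples X, ¬ (Q (t 0) (t 1) ∧ Q (t 1) (t 2) ∧ Q (t 0) (t 2))) :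
    ∃ w', IsMetricOn w' ∧ (∀ u v, w' u v ≤ 4) ∧ ∀ u v, Q u v → w' u v = weight X u v := by
  refine ⟨cappedWeight X Q, isMetricOn_cappedWeight hX Q hQ fun i x hx hq => ?_,
    (hasCliqueBounds_cappedWeight X Q hQ).le_four, fun u v huv => by simp [cappedWeight, huv]⟩
  refine h (triple (i, x)) ?_ hq
  simp only [triples, mem_image]
  exact ⟨(i, x), by simp [hx], rfl⟩

lemma isObstruction_weight [NeZero n] (hX : ThreeAPFree (X : Set (ZMod n))) :
    IsObstruction (weight X) (triples X) where
  nonneg := (hasCliqueBounds_weight X).nonneg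
  symm := (hasCliqueBounds_weight X).symm
  diag := (hasCliqueBounds_weight X).diag
  extend Q hQ h := by
    obtain ⟨w', h1, -, h2⟩ := exists_bounded_extension hX Q hQ h
    exact ⟨w', h1, h2⟩

/-- The extension of a weight function to `r` further vertices at distance `2` from each other
and from all the others. -/
def padWeight {V : Type} (r : ℕ) (w : V → V → ℝ) : V ⊕ Fin r → V ⊕ Fin r → ℝ
  | .inl u, .inl v => w u v
  | .inr p, .inr p' => if p = p' then 0 else 2
  | .inl _, .inr _ => 2
  | .inr _, .inl _ => 2

lemma IsMetricOn.padWeight {V : Type} {w : V → V → ℝ} (h : IsMetricOn w)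
    (h4 : ∀ u v, w u v ≤ 4) (r : ℕ) : IsMetricOn (padWeight r w) where
  nonneg u v := by
    rcases u with u | p <;> rcases v with v | p' <;> simp only [MetricTesting.padWeight]
    · exact h.nonneg u v
    · norm_num
    · norm_num
    · split_ifs <;> norm_num
  eq_zero_iff u v := by
    rcases u with u | p <;> rcases v with v | p' <;>
      simp [MetricTesting.padWeight, h.eq_zero_iff]
  symm u v := by
    rcases u with u | p <;> rcases v with v | p' <;> simp [MetricTesting.padWeight, eq_comm]
    exact h.symm u v
  triangle u v t := by
    rcases u with u | p <;> rcases v with v | p' <;> rcases t with t | p'' <;>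
      simp only [MetricTesting.padWeight]
    · exact h.triangle u v t
    · linarith [h4 u v]
    · linarith [h.nonneg u t]
    · split_ifs <;> norm_num
    · linarith [h.nonneg v t]
    · split_ifs <;> norm_num
    · split_ifs <;> norm_num
    · split_ifs <;> simp_all

lemma isObstruction_padWeight [NeZero n] (hX : ThreeAPFree (X : Set (ZMod n))) (r : ℕ) :
    IsObstruction (padWeight r (weight X)) ((triples X).map
      ⟨fun t => t.trans .inl, fun s t h => by
        ext k
        exact Sum.inl_injective (congrArg (fun e : Fin 3 ↪ Vertex n ⊕ Fin r => e k) h)⟩) where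
  nonneg u v := by
    rcases u with u | p <;> rcases v with v | p' <;> simp only [padWeight]
    · exact (hasCliqueBounds_weight X).nonneg u v
    · norm_num
    · norm_num
    · split_ifs <;> norm_num
  symm u v := by
    rcases u with u | p <;> rcases v with v | p' <;> simp [padWeight, eq_comm]
    exact weight_symm X u v
  diag u := by
    rcases u with u | p <;> simp [padWeight, (hasCliqueBounds_weight X).diag]
  extend Q hQ h := by
    obtain ⟨w', h1, h2, h3⟩ := exists_bounded_extension hX (fun u v => Q (.inl u) (.inl v))
      (fun u v => hQ _ _) (fun t ht => h _ (mem_map_of_mem _ ht))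
    refine ⟨_, h1.padWeight h2 r, fun u v huv => ?_⟩
    rcases u with u | p <;> rcases v with v | p' <;> simp only [padWeight]
    exact h3 u v huv

end Clique

end MetricTesting

/-! ### Large 3-AP-free sets from Behrend's bound, and asymptotics of `nu`. -/

namespace MetricTesting

open Filter Topology

/-- Sums of two integers below `(m + 1) / 2` stay below `m`, so no progression arises by wrapping
around. Subsets inherit freeness, which allows any size up to the Roth number. -/
lemma exists_threeAPFree (m k : ℕ) [NeZero m] (h : k ≤ rothNumberNat ((m + 1) / 2)) :
    ∃ X : Finset (ZMod m), ThreeAPFree (X : Set (ZMod m)) ∧ X.card = k := by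
  obtain ⟨t, ht, hcard, hfree⟩ := rothNumberNat_spec ((m + 1) / 2)
  have hlt : ∀ a ∈ t, a < (m + 1) / 2 := fun a ha => Finset.mem_range.1 (ht ha)
  obtain ⟨s, hst, hs⟩ := Finset.exists_subset_card_eq (hcard ▸ h)
  refine ⟨s.image (Nat.cast : ℕ → ZMod m), ?_, ?_⟩
  · intro x hx y hy z hz hxyz
    simp only [Finset.coe_image, Set.mem_image, Finset.mem_coe] at hx hy hz
    obtain ⟨a, ha, rfl⟩ := hx
    obtain ⟨b, hb, rfl⟩ := hy
    obtain ⟨c, hc, rfl⟩ := hz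
    have ha' := hlt a (hst ha)
    have hb' := hlt b (hst hb)
    have hc' := hlt c (hst hc)
    have heq : ((a + c : ℕ) : ZMod m) = ((b + b : ℕ) : ZMod m) := by
      push_cast
      exact hxyz
    rw [ZMod.natCast_eq_natCast_iff] at heq
    have hab : a + c = b + b :=
      Nat.ModEq.eq_of_lt_of_lt heq (by omega) (by omega)
    rw [hfree (hst ha) (hst hb) (hst hc) hab]
  · rw [Finset.card_image_of_injOn, hs]
    intro a ha b hb hab
    have ha' := hlt a (hst ha)
    have hb' := hlt b (hst hb)
    simp only [ZMod.natCast_eq_natCast_iff] at hab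
    exact Nat.ModEq.eq_of_lt_of_lt hab (by omega) (by omega)

variable {b : ℝ} (hb : 1 < b)

include hb

lemma tendsto_logb_logb : Tendsto (fun n : ℕ => Real.logb b (Real.logb b n)) atTop atTop :=
  (Real.tendsto_logb_atTop hb).comp
    ((Real.tendsto_logb_atTop hb).comp tendsto_natCast_atTop_atTop)

lemma tendsto_nu : Tendsto (fun n : ℕ => nu b n) atTop (𝓝 0) := by
  have h1 : Tendsto (fun y : ℝ => (Real.logb b y + 4) / y) atTop (𝓝 0) := by
    have h2 : Tendsto (fun y : ℝ => Real.log y / y) atTop (𝓝 0) :=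
      Real.isLittleO_log_id_atTop.tendsto_div_nhds_zero
    have h3 : Tendsto (fun y : ℝ => (4 : ℝ) / y) atTop (𝓝 0) :=
      tendsto_const_nhds.div_atTop tendsto_id
    have h4 := (h2.div_const (Real.log b)).add h3
    rw [zero_div, add_zero] at h4
    refine h4.congr fun y => ?_
    rw [Real.logb]
    ring
  exact h1.comp (tendsto_logb_logb hb)

/-- Eventually `nu b n` is at least the reciprocal of the iterated logarithm, and `log n / log log
n` outgrows `√(log n)`. The constant is `35 = 5 * 7`: a factor 5 in the size wanted, and 7 from `n /
7 ≤ n / 6` with the right side rounded down. -/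
lemma eventually_le_nu_mul_log : ∀ᶠ n : ℕ in atTop,
    4 * √(Real.log n) + Real.log 35 ≤ nu b n * Real.log n := by
  have hlb : 0 < Real.log b := Real.log_pos hb
  have hsb : 0 < √(Real.log b) := Real.sqrt_pos.2 hlb
  have hz : Tendsto (fun n : ℕ => Real.logb b n) atTop atTop :=
    (Real.tendsto_logb_atTop hb).comp tendsto_natCast_atTop_atTop
  have hlog : Tendsto (fun n : ℕ => Real.log n) atTop atTop :=
    Real.tendsto_log_atTop.comp tendsto_natCast_atTop_atTop
  -- The constant for which `log z ≤ c * √z` turns into `h8` after the change of base.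
  have hc : 0 < Real.log b ^ 2 / (5 * √(Real.log b)) := by positivity
  have hlit := (isLittleO_log_rpow_atTop (r := 1 / 2) (by norm_num)).bound hc
  filter_upwards [hz.eventually hlit, hz.eventually_gt_atTop 1, hlog.eventually_ge_atTop
    (Real.log 35 ^ 2), (tendsto_logb_logb hb).eventually_ge_atTop 1] with n h1 h2 h3 h4
  set z := Real.logb b n with hzdef
  have hln : Real.log n = z * Real.log b := by
    rw [hzdef, Real.logb, div_mul_cancel₀ _ hlb.ne']
  have hz0 : 0 < z := by linarith
  have hlz : 0 < Real.log z := Real.log_pos h2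
  rw [← Real.sqrt_eq_rpow, Real.norm_of_nonneg hlz.le, Real.norm_of_nonneg (Real.sqrt_nonneg _)]
    at h1
  have h5 : Real.log 35 ≤ √(Real.log n) := Real.le_sqrt_of_sq_le h3
  have h6 : √(Real.log n) = √z * √(Real.log b) := by rw [hln, Real.sqrt_mul hz0.le]
  have h7 : 1 / Real.logb b z ≤ nu b n := by
    rw [nu, ← hzdef]
    have := Real.logb_nonneg hb h4
    gcongr
    linarith
  have h8 : 5 * √(Real.log n) ≤ 1 / Real.logb b z * Real.log n := by
    rw [h6, hln, Real.logb, one_div_div, div_mul_eq_mul_div, le_div_iff₀ hlz]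
    calc 5 * (√z * √(Real.log b)) * Real.log z
        ≤ 5 * (√z * √(Real.log b)) * (Real.log b ^ 2 / (5 * √(Real.log b)) * √z) := by gcongr
      _ = (√z * √z) * Real.log b ^ 2 := by field_simp
      _ = Real.log b * (z * Real.log b) := by rw [Real.mul_self_sqrt hz0.le]; ring
  have h9 : 0 ≤ Real.log n := by rw [hln]; positivity
  calc _ ≤ 5 * √(Real.log n) := by linarith
    _ ≤ _ := h8
    _ ≤ _ := by gcongr

/-- The argument `n / 6` is at most `(m + 1) / 2` both for `m = n` and for `m = n / 3`, the two
moduli needed. -/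
lemma eventually_le_rothNumberNat : ∀ᶠ n : ℕ in atTop,
    5 * (n : ℝ) ^ (1 - nu b n) ≤ rothNumberNat (n / 6) := by
  filter_upwards [eventually_le_nu_mul_log hb, eventually_ge_atTop 42] with n h hn
  have hn0 : (0 : ℝ) < n := by exact_mod_cast (by omega : 0 < n)
  have h1 : (n : ℝ) / 7 ≤ (n / 6 : ℕ) := by
    rw [div_le_iff₀ (by norm_num)]
    exact_mod_cast (by omega : n ≤ n / 6 * 7)
  have h2 : ((n / 6 : ℕ) : ℝ) ≤ n := by exact_mod_cast Nat.div_le_self n 6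
  have h3 : (0 : ℝ) < (n / 6 : ℕ) := lt_of_lt_of_le (by positivity) h1
  calc 5 * (n : ℝ) ^ (1 - nu b n) = 5 * (n * Real.exp (-(nu b n * Real.log n))) := by
        rw [Real.rpow_sub hn0, Real.rpow_one, Real.rpow_def_of_pos hn0, Real.exp_neg,
          div_eq_mul_inv, mul_comm (Real.log _)]
    _ ≤ 5 * (n * Real.exp (-4 * √(Real.log n) - Real.log 35)) := by
        gcongr
        linarith
    _ = n / 7 * Real.exp (-4 * √(Real.log n)) := by
        rw [Real.exp_sub, Real.exp_log (by norm_num)]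
        ring
    _ ≤ (n / 6 : ℕ) * Real.exp (-4 * √(Real.log (n / 6 : ℕ))) := by
        have : √(Real.log (n / 6 : ℕ)) ≤ √(Real.log n) :=
          Real.sqrt_le_sqrt (Real.log_le_log h3 h2)
        gcongr ?_ * Real.exp ?_
        linarith
    _ ≤ _ := Behrend.roth_lower_bound

/-- Leaves room for rounding the size of `X` up to an integer. -/
lemma eventually_four_le_rpow : ∀ᶠ n : ℕ in atTop, 4 ≤ (n : ℝ) ^ (1 - nu b n) := by
  filter_upwards [(tendsto_nu hb).eventually_le_const (by norm_num : (0 : ℝ) < 1 / 2),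
    eventually_ge_atTop 16] with n h hn
  have hn' : (16 : ℝ) ≤ n := by exact_mod_cast hn
  calc (4 : ℝ) = √16 := by
        rw [show (16 : ℝ) = 4 ^ 2 by norm_num, Real.sqrt_sq (by norm_num)]
    _ ≤ √n := Real.sqrt_le_sqrt hn'
    _ = (n : ℝ) ^ (1 / 2 : ℝ) := Real.sqrt_eq_rpow _
    _ ≤ _ := Real.rpow_le_rpow_of_exponent_le (by linarith) (by linarith)

end MetricTesting

/-! ### From triangle counts to the query bounds. -/

namespace MetricTesting

open Filter Topology

/-- Since `c ^ 3 ≤ c`, no cube root of the constant is needed. -/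
lemma le_of_pow_three_le {c A q : ℝ} (hc0 : 0 ≤ c) (hc1 : c ≤ 1) (hq : 0 ≤ q)
    (h : c * A ^ 3 ≤ q ^ 3) (hA : 0 ≤ A) : c * A ≤ q := by
  refine le_of_pow_le_pow_left₀ three_ne_zero hq (le_trans ?_ h)
  rw [mul_pow]
  gcongr
  exact pow_le_of_le_one hc0 hc1 three_ne_zero

lemma pow_three_le_descFactorial {n N : ℕ} (hn : 4 ≤ n) (hnN : n ≤ N) :
    (n : ℝ) ^ 3 / 4 ≤ N.descFactorial 3 := by
  have h1 : (n : ℝ) ^ 3 / 4 ≤ (N : ℝ) ^ 3 / 4 := by gcongr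
  refine h1.trans ?_
  have hN : 4 ≤ N := hn.trans hnN
  have h2 : N.descFactorial 3 = (N - 2) * ((N - 1) * N) := by
    simp [Nat.descFactorial]
  rw [h2]
  push_cast [Nat.cast_sub (show 2 ≤ N by omega), Nat.cast_sub (show 1 ≤ N by omega)]
  have h3 : (4 : ℝ) ≤ N := by exact_mod_cast hN
  have h4 : (N : ℝ) / 2 * (N / 2 * N) ≤ (N - 2) * ((N - 1) * N) := by
    gcongr ?_ * (?_ * _) <;> linarith
  linarith

/-- The query bounds for a tester that rejects a randomly labelled obstruction with few
triangles. -/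
theorem IsObstruction.query_bound {N n : ℕ} {V : Type} [Fintype V] [DecidableEq V]
    {w : V → V → ℝ} {T : Finset (Fin 3 ↪ V)} (h : IsObstruction w T) {K ν : ℝ} (hK : 1 ≤ K)
    (hn : 4 ≤ n) (hnN : n ≤ N) (hν : ν ≤ 1 / 2)
    (hT : (T.card : ℝ) ≤ K * (n : ℝ) ^ (2 - ν)) (A : Tester N) (hA : A.IsOneSided) (q : ℕ)
    (hq : A.MakesAtMost q) (hN : Nonempty (Fin N ≃ V))
    (hrej : 2 / 3 * (Fintype.card (Fin N ≃ V) : ℝ) ≤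
      ∑ ψ : Fin N ≃ V, A.rejectProb (labelled w ψ)) :
    1 / (288 * K ^ 2) * (n : ℝ) ^ (1 / 3 + ν / 3) ≤ q ∧
      (A.IsNonadaptive → 1 / (288 * K ^ 2) * (n : ℝ) ^ (2 / 3 + 2 * ν / 3) ≤ q) := by
  have hn4 : (4 : ℝ) ≤ n := by exact_mod_cast hn
  have hn0 : (0 : ℝ) < n := by linarith
  have hK2 : 1 ≤ K ^ 2 := one_le_pow₀ hK
  -- `288 = 36 * 8` is what the squared non-adaptive estimate costs; the adaptive one needs only `48
  -- * K`.
  have hc0 : 0 ≤ 1 / (288 * K ^ 2) := by positivity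
  have hc1 : 1 / (288 * K ^ 2) ≤ 1 / 2 := by
    rw [div_le_div_iff₀ (by positivity) (by norm_num)]
    linarith
  have hd := pow_three_le_descFactorial hn hnN
  have hB : (0 : ℝ) < (n : ℝ) ^ (2 - ν) := Real.rpow_pos_of_pos hn0 _
  refine ⟨?_, fun hna => ?_⟩
  · rcases le_or_gt (2 * q) N with hqN | hqN
    · have key := h.adaptive_bound A hA q hq hqN hN hrej
      refine le_of_pow_three_le hc0 (by linarith) (by positivity) ?_ (by positivity)
      have h1 : ((n : ℝ) ^ (1 / 3 + ν / 3)) ^ 3 * (n : ℝ) ^ (2 - ν) = (n : ℝ) ^ 3 := by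
        rw [← Real.rpow_natCast, ← Real.rpow_mul hn0.le, ← Real.rpow_add hn0,
          ← Real.rpow_natCast]
        congr 1
        push_cast
        ring
      have h2 : (n : ℝ) ^ 3 / 6 ≤ (2 * q) ^ 3 * (K * (n : ℝ) ^ (2 - ν)) :=
        calc _ ≤ 2 / 3 * (N.descFactorial 3 : ℝ) := by linarith
          _ ≤ _ := key
          _ ≤ _ := by gcongr
      rw [← h1] at h2
      have h3 : ((n : ℝ) ^ (1 / 3 + ν / 3)) ^ 3 ≤ 48 * (q : ℝ) ^ 3 * K := by
        refine le_of_mul_le_mul_right ?_ hB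
        linarith
      rw [one_div_mul_eq_div, div_le_iff₀ (by positivity)]
      calc _ ≤ _ := h3
        _ ≤ 48 * (q : ℝ) ^ 3 * K ^ 2 := by
          gcongr
          exact le_self_pow₀ hK two_ne_zero
        _ ≤ (q : ℝ) ^ 3 * (288 * K ^ 2) := by
          have : 0 ≤ (q : ℝ) ^ 3 * K ^ 2 := by positivity
          linarith
    · have h1 : (n : ℝ) ≤ 2 * q := by exact_mod_cast (hnN.trans hqN.le)
      have h2 : (n : ℝ) ^ (1 / 3 + ν / 3) ≤ n := by
        conv_rhs => rw [← Real.rpow_one (n : ℝ)]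
        exact Real.rpow_le_rpow_of_exponent_le (by linarith) (by linarith)
      calc _ ≤ 1 / 2 * (n : ℝ) := by gcongr
        _ ≤ q := by linarith
  · have key := h.nonadaptive_bound A hA q hq hna hN hrej
    refine le_of_pow_three_le hc0 (by linarith) (by positivity) ?_ (by positivity)
    have h1 : ((n : ℝ) ^ (2 / 3 + 2 * ν / 3)) ^ 3 * ((n : ℝ) ^ (2 - ν)) ^ 2 =
        ((n : ℝ) ^ 3) ^ 2 := by
      rw [← Real.rpow_natCast, ← Real.rpow_mul hn0.le, ← Real.rpow_natCast _ 2,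
        ← Real.rpow_mul hn0.le, ← Real.rpow_add hn0, ← pow_mul, ← Real.rpow_natCast]
      congr 1
      push_cast
      ring
    have h2 : ((n : ℝ) ^ 3) ^ 2 / 36 ≤ (2 * q) ^ 3 * (K * (n : ℝ) ^ (2 - ν)) ^ 2 :=
      calc ((n : ℝ) ^ 3) ^ 2 / 36 = (2 / 3 * ((n : ℝ) ^ 3 / 4)) ^ 2 := by ring
        _ ≤ (2 / 3 * (N.descFactorial 3 : ℝ)) ^ 2 := by gcongr
        _ ≤ _ := key
        _ ≤ _ := by gcongr
    rw [← h1] at h2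
    rw [one_div_mul_eq_div, div_le_iff₀ (by positivity)]
    refine le_of_mul_le_mul_right ?_ (pow_pos hB 2)
    linarith

theorem tester_lower_bound (b : ℝ) (hb : 1 < b) :
    ∃ c : ℝ, 0 < c ∧ ∃ n₀ : ℕ, ∀ n : ℕ, n₀ ≤ n → ∀ ε : ℝ, ε ≤ (n : ℝ) ^ (-nu b n) →
      ∀ (T : Tester n) (q : ℕ), T.IsOneSidedTester ε → T.MakesAtMost q →
        c * (n : ℝ) ^ (1 / 3 + nu b n / 3) ≤ (q : ℝ) ∧
        (T.IsNonadaptive → c * (n : ℝ) ^ (2 / 3 + 2 * nu b n / 3) ≤ (q : ℝ)) := by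
  refine ⟨1 / (288 * 3 ^ 2), by norm_num, ?_⟩
  obtain ⟨n₀, h₀⟩ := eventually_atTop.1 ((eventually_le_rothNumberNat hb).and
    ((eventually_four_le_rpow hb).and
      ((tendsto_nu hb).eventually_le_const (by norm_num : (0 : ℝ) < 1 / 2))))
  refine ⟨max n₀ 12, fun n hn ε hε A q hA hq => ?_⟩
  obtain ⟨hroth, hfour, hnu⟩ := h₀ n ((le_max_left _ _).trans hn)
  have hn12 : 12 ≤ n := (le_max_right _ _).trans hn
  have hn0 : (0 : ℝ) < n := by exact_mod_cast (by omega : 0 < n)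
  set m := n / 3 with hm
  have hm0 : (0 : ℝ) < m := by exact_mod_cast (by omega : 0 < m)
  have : NeZero m := ⟨by omega⟩
  have hnm : (n : ℝ) ≤ 4 * m := by exact_mod_cast (by omega : n ≤ 4 * m)
  have hmn : (m : ℝ) ≤ n := by exact_mod_cast (by omega : m ≤ n)
  have hpow : (n : ℝ) ^ (2 - nu b n) = n * (n : ℝ) ^ (1 - nu b n) := by
    rw [← Real.rpow_one_add' hn0.le (by linarith)]
    congr 1
    ring
  have hpow' : (n : ℝ) ^ (-nu b n) * (n : ℝ) ^ 2 = n * (n : ℝ) ^ (1 - nu b n) := by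
    rw [← hpow, ← Real.rpow_natCast, ← Real.rpow_add hn0]
    congr 1
    push_cast
    ring
  set x := (n : ℝ) ^ (1 - nu b n)
  -- The least size with `2 * m * k ≥ n * x`, the required farness; `n ≤ 4 * m` keeps it below `3 *
  -- x`, whence `K = 3`.
  set k := ⌈n * x / (2 * m)⌉₊
  have hk1 : n * x / (2 * m) ≤ k := Nat.le_ceil _
  have hk2 : (k : ℝ) ≤ 3 * x := by
    have h1 : (k : ℝ) < n * x / (2 * m) + 1 := Nat.ceil_lt_add_one (by positivity)
    have h2 : n * x / (2 * m) ≤ 2 * x := by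
      rw [div_le_iff₀ (by positivity)]
      calc n * x ≤ 4 * m * x := by gcongr
        _ = _ := by ring
    linarith
  obtain ⟨X, hX, hXk⟩ := exists_threeAPFree m k (by
    have h1 : (k : ℝ) ≤ rothNumberNat (n / 6) := by linarith
    exact (Nat.cast_le.1 h1).trans (rothNumberNat.mono (by omega)))
  have hobs := isObstruction_padWeight hX (n % 3)
  have hne : Nonempty (Fin n ≃ Vertex m ⊕ Fin (n % 3)) := by
    refine Fintype.card_eq.1 ?_
    simp only [Fintype.card_sum, Fintype.card_fin, ZMod.card]
    omega
  refine hobs.query_bound (K := 3) (by norm_num) (by omega) le_rfl hnu ?_ A hA.1 q hq hne ?_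
  · rw [Finset.card_map, hpow]
    calc ((triples X).card : ℝ) ≤ m * X.card := by exact_mod_cast card_triples_le X
      _ ≤ n * (3 * x) := by
        rw [hXk]
        gcongr
      _ = _ := by ring
  · rw [mul_comm, ← nsmul_eq_mul, ← Finset.card_univ]
    refine Finset.card_nsmul_le_sum _ _ _ fun ψ _ => hA.2 _ (hobs.isDistanceMatrix ψ) ?_
    intro M' hM'
    have hdist := two_mul_le_entryDist hX
      ((Function.Embedding.inl : Vertex m ↪ Vertex m ⊕ Fin (n % 3)).trans ψ.symm.toEmbedding)
      (labelled (padWeight (n % 3) (weight X)) ψ) M' hM' (by simp [labelled, padWeight])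
    calc ε * (n : ℝ) ^ 2 ≤ (n : ℝ) ^ (-nu b n) * (n : ℝ) ^ 2 := by gcongr
      _ = n * x := hpow'
      _ ≤ 2 * m * X.card := by
        rw [hXk, mul_comm]
        rw [div_le_iff₀ (by positivity)] at hk1
        linarith
      _ ≤ _ := by exact_mod_cast hdist

theorem exists_threeAPFree_isFar (b : ℝ) (hb : 1 < b) :
    ∃ n₀ : ℕ, ∀ (n : ℕ) [NeZero n], n₀ ≤ n →
      ∃ X : Finset (ZMod n), ThreeAPFree (X : Set (ZMod n)) ∧
        (n : ℝ) ^ (1 - nu b n) ≤ (X.card : ℝ) ∧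
        (X.card : ℝ) ≤ 5 * (n : ℝ) ^ (1 - nu b n) ∧
        ∀ ψ : Fin (3 * n) ≃ Vertex n, IsFar ((n : ℝ) ^ (-nu b n)) (cliqueMatrix X ψ) := by
  obtain ⟨n₀, h₀⟩ := eventually_atTop.1 ((eventually_le_rothNumberNat hb).and
    (eventually_four_le_rpow hb))
  refine ⟨n₀, fun n _ hn => ?_⟩
  obtain ⟨hroth, hfour⟩ := h₀ n hn
  have hn0 : (0 : ℝ) < n := by exact_mod_cast NeZero.pos n
  have hpow : (n : ℝ) ^ (-nu b n) * n = (n : ℝ) ^ (1 - nu b n) := by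
    rw [← Real.rpow_add_one hn0.ne']
    congr 1
    ring
  set x := (n : ℝ) ^ (1 - nu b n)
  -- The matrix has side `3 * n`, so farness requires `2 * n * k ≥ 9 * n * x`.
  set k := ⌈9 / 2 * x⌉₊
  have hk1 : 9 / 2 * x ≤ k := Nat.le_ceil _
  have hk2 : (k : ℝ) ≤ 5 * x := by
    have h1 : (k : ℝ) < 9 / 2 * x + 1 := Nat.ceil_lt_add_one (by positivity)
    linarith
  obtain ⟨X, hX, hXk⟩ := exists_threeAPFree n k
    ((Nat.cast_le.1 (hk2.trans hroth)).trans (rothNumberNat.mono (by omega)))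
  rw [← hXk] at hk1 hk2
  refine ⟨X, hX, by linarith, hk2, fun ψ M' hM' => ?_⟩
  have hdist := two_mul_le_entryDist hX ψ.symm.toEmbedding (cliqueMatrix X ψ) M' hM'
    (by simp [cliqueMatrix])
  calc (n : ℝ) ^ (-nu b n) * ((3 * n : ℕ) : ℝ) ^ 2 = 9 * ((n : ℝ) ^ (-nu b n) * n) * n := by
        push_cast
        ring
    _ = 2 * n * (9 / 2 * x) := by
        rw [hpow]
        ring
    _ ≤ 2 * n * X.card := by gcongr
    _ ≤ _ := by exact_mod_cast hdist

theorem clique_lower_bound (b : ℝ) (hb : 1 < b) (K : ℝ) :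
    ∃ c : ℝ, 0 < c ∧ ∃ n₀ : ℕ, ∀ (n : ℕ) [NeZero n], n₀ ≤ n →
      ∀ X : Finset (ZMod n), ThreeAPFree (X : Set (ZMod n)) →
        (X.card : ℝ) ≤ K * (n : ℝ) ^ (1 - nu b n) →
        ∀ (T : Tester (3 * n)) (q : ℕ), T.IsOneSided → T.MakesAtMost q →
          2 / 3 ≤ avgRejectProb T X →
          c * (n : ℝ) ^ (1 / 3 + nu b n / 3) ≤ (q : ℝ) ∧
          (T.IsNonadaptive → c * (n : ℝ) ^ (2 / 3 + 2 * nu b n / 3) ≤ (q : ℝ)) := by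
  -- `K` is arbitrary, possibly negative, while `query_bound` needs a constant at least 1.
  refine ⟨1 / (288 * (max K 1) ^ 2), by positivity, ?_⟩
  obtain ⟨n₀, h₀⟩ := eventually_atTop.1
    ((tendsto_nu hb).eventually_le_const (by norm_num : (0 : ℝ) < 1 / 2))
  refine ⟨max n₀ 4, fun n _ hn X hX hXK A q hA hq hrej => ?_⟩
  have hnu := h₀ n ((le_max_left _ _).trans hn)
  have hn4 : 4 ≤ n := (le_max_right _ _).trans hn
  have hn0 : (0 : ℝ) < n := by exact_mod_cast NeZero.pos n
  have hne : Nonempty (Fin (3 * n) ≃ Vertex n) := by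
    refine Fintype.card_eq.1 ?_
    simp only [Fintype.card_sum, Fintype.card_fin, ZMod.card]
    omega
  refine (isObstruction_weight hX).query_bound (le_max_right _ _) hn4 (by omega) hnu ?_ A hA q hq
    hne ?_
  · calc ((triples X).card : ℝ) ≤ n * X.card := by exact_mod_cast card_triples_le X
      _ ≤ n * (max K 1 * (n : ℝ) ^ (1 - nu b n)) := by
        gcongr
        exact hXK.trans (by gcongr; exact le_max_left _ _)
      _ = max K 1 * (n : ℝ) ^ (2 - nu b n) := by
        rw [mul_left_comm, ← Real.rpow_one_add' hn0.le (by linarith)]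
        congr 2
        ring
  · have hpos : (0 : ℝ) < Fintype.card (Fin (3 * n) ≃ Vertex n) := by
      exact_mod_cast Fintype.card_pos_iff.2 hne
    rw [avgRejectProb] at hrej
    exact (le_div_iff₀ hpos).1 hrej

end MetricTesting

theorem mainTheorem2 (b : ℝ) (hb : 1 < b) :
    -- the lower bound for one-sided testers
    (∃ c : ℝ, 0 < c ∧ ∃ n₀ : ℕ, ∀ n : ℕ, n₀ ≤ n → ∀ ε : ℝ, ε ≤ (n : ℝ) ^ (-nu b n) →
      ∀ (T : Tester n) (q : ℕ), T.IsOneSidedTester ε → T.MakesAtMost q →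
        c * (n : ℝ) ^ (1 / 3 + nu b n / 3) ≤ (q : ℝ) ∧
        (T.IsNonadaptive → c * (n : ℝ) ^ (2 / 3 + 2 * nu b n / 3) ≤ (q : ℝ))) ∧
    -- violating triangles and farness of the weighted clique of any 3-AP-free set
    (∀ (n : ℕ) [NeZero n] (X : Finset (ZMod n)), ThreeAPFree (X : Set (ZMod n)) →
      {s : Finset (Vertex n) | IsViolatingTriangle (weight X) s}.ncard = n * X.card ∧
      (∀ s s' : Finset (Vertex n), IsViolatingTriangle (weight X) s →
        IsViolatingTriangle (weight X) s' → s ≠ s' → (s ∩ s').card ≤ 1) ∧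
      ∀ ψ : Fin (3 * n) ≃ Vertex n,
        IsLeast {k : ℕ | ∃ M' : Matrix (Fin (3 * n)) (Fin (3 * n)) ℝ,
          IsMetric M' ∧ entryDist (cliqueMatrix X ψ) M' = k} (2 * n * X.card)) ∧
    -- large 3-AP-free sets, whose weighted cliques are far from metrics
    (∃ n₀ : ℕ, ∀ (n : ℕ) [NeZero n], n₀ ≤ n →
      ∃ X : Finset (ZMod n), ThreeAPFree (X : Set (ZMod n)) ∧
        (n : ℝ) ^ (1 - nu b n) ≤ (X.card : ℝ) ∧
        (X.card : ℝ) ≤ 5 * (n : ℝ) ^ (1 - nu b n) ∧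
        ∀ ψ : Fin (3 * n) ≃ Vertex n, IsFar ((n : ℝ) ^ (-nu b n)) (cliqueMatrix X ψ)) ∧
    -- the lower bound for detecting a violation in these weighted cliques
    (∀ K : ℝ, ∃ c : ℝ, 0 < c ∧ ∃ n₀ : ℕ, ∀ (n : ℕ) [NeZero n], n₀ ≤ n →
      ∀ X : Finset (ZMod n), ThreeAPFree (X : Set (ZMod n)) →
        (X.card : ℝ) ≤ K * (n : ℝ) ^ (1 - nu b n) →
        ∀ (T : Tester (3 * n)) (q : ℕ), T.IsOneSided → T.MakesAtMost q →
          2 / 3 ≤ avgRejectProb T X →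
          c * (n : ℝ) ^ (1 / 3 + nu b n / 3) ≤ (q : ℝ) ∧
          (T.IsNonadaptive → c * (n : ℝ) ^ (2 / 3 + 2 * nu b n / 3) ≤ (q : ℝ))) :=
  ⟨tester_lower_bound b hb,
    fun _ _ _ hX => ⟨ncard_isViolatingTriangle hX, card_inter_le_one hX, isLeast_entryDist hX⟩,
    exists_threeAPFree_isFar b hb, clique_lower_bound b hb⟩
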